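/- Let $\mathbb F$ be a field with four elements and let $\alpha\in\mathbb F$ satisfy $\alpha^2+\alpha+1=0$. For $x,y,z\in\mathbb F$ put $$M(x,y,z)=\begin{pmatrix}1&-x&y&z\\0&1&0&y\\0&0&1&x\\0&0&0&1\end{pmatrix},$$ and let $S=\{M(x,y,z)\mid x,y,z\in\mathbb F\}\le \mathrm{SL}_4(\mathbb F)$, an elementary abelian group of order $64$. Let $X_0=\{M(0,0,\mu)\mid\mu\in\mathbb F\}$ and, for each point $[a:b]$ of the projective line over $\mathbb F$, let $X_{[a:b]}=\{M(\mu a,\mu b,0)\mid \mu\in\mathbb F\}$. Let $Q$ be the generalized quadrangle of order $(3,5)$ whose points are the elements of $S$, whose lines are the left cosets in $S$ of $X_0$ and of the subgroups $X_{[a:b]}$, and whose incidence is membership; its chambers are the edges of its incidence graph, i.e. the incident point-line pairs, and $\mathrm{Aut}(Q)$ is the automorphism group of its incidence graph. A subgroup of $\mathrm{Aut}(Q)$ is called chamber-regular if it acts regularly (simply transitively) on the chambers. Let $V=\mathbb F_2^6$ with standard basis $e_1,\dots,e_6$, and identify the point set $S$ with $V$ by the group isomorphism $\Phi:S\to V$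 that maps $M(1,0,0)$, $M(\alpha,0,0)$, $M(0,1,0)$, $M(0,\alpha,0)$, $M(0,0,1)$, $M(0,0,\alpha)$ to $e_1,\dots,e_6$, respectively. Put $U_1=\langle e_5,e_6\rangle$, $U_2=\langle e_1,e_2\rangle$, $U_3=\langle e_3,e_4\rangle$, $U_4=\langle e_1+e_3+e_5,\ e_2+e_4+e_5+e_6\rangle$, $U_5=\langle e_1+e_4+e_6,\ e_2+e_3+e_4+e_5\rangle$, $U_6=\langle e_2+e_3+e_6,\ e_1+e_2+e_4+e_5\rangle$. Consider the following matrices in $\mathrm{GL}_6(\mathbb F_2)$, acting on column vectors by left multiplication: $$A=\begin{pmatrix}0&0&1&1&1&1\\ 0&0&0&1&1&0\\ 1&1&1&1&1&0\\ 0&1&0&1&0&1\\ 0&0&1&0&1&0\\ 0&0&0&1&1&1\end{pmatrix},\quad B=\begin{pmatrix}1&0&1&1&0&1\\ 1&1&0&1&1&1\\ 1&1&1&1&1&0\\ 0&1&0&1&0&1\\ 1&1&1&0&0&1\\ 1&0&0&1&1&0\end{pmatrix},$$ $$C=\begin{pmatrix}1&1&0&1&0&0\\ 1&0&1&1&0&0\\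 1&1&1&1&1&0\\ 1&0&1&0&1&1\\ 0&1&1&1&0&0\\ 1&0&0&1&0&0\end{pmatrix},\quad D=\begin{pmatrix}0&1&0&0&0&0\\ 1&1&0&0&0&0\\ 0&0&0&1&0&0\\ 0&0&1&1&0&0\\ 0&0&0&0&1&1\\ 0&0&0&0&1&0\end{pmatrix}.$$ For $H\le\mathrm{GL}_6(\mathbb F_2)$ the affine group $V\rtimes H$ acts on $V$ by the maps $v\mapsto hv+t$ ($h\in H$, $t\in V$). **Proposition 4.2.** 1. The affine group $V\rtimes\langle A,C\rangle$ is the full automorphism group of $Q$: every element of it induces, through $\Phi$, an automorphism of $Q$, and this gives an isomorphism $V\rtimes\langle A,C\rangle\cong\mathrm{Aut}(Q)$. In particular the translation group $V$ is a normal subgroup of $\mathrm{Aut}(Q)$ that acts regularly on the points. 2. One has $B\in\langle A,C\rangle$, and up to conjugacy in $\mathrm{Aut}(Q)$ there are exactly two chamber-regular subgroups of $\mathrm{Aut}(Q)$ that contain $V$, namely $V\rtimes\langle A\rangle$ and $V\rtimes\langle B,C\rangle$. That is, these two groups are chamber-regular, contain $V$ and are not conjugate, and every chamber-regular subgroup containing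 $V$ is conjugate to one of them. 3. The group $\langle A,C\rangle$ permutes the subspaces $U_1,\dots,U_6$. The resulting homomorphism $\Psi:\langle A,C\rangle\to\mathrm{Sym}(6)$ is surjective, with $\Psi(A)=(1,5,2,3,4,6)$ and $\Psi(C)=(1,3,5)(2,4,6)$; its kernel is $\langle D\rangle$, which is cyclic of order three; and the exact sequence $$1\to C_3\cong\langle D\rangle\to\langle A,C\rangle\to\mathrm{Sym}(6)\to1$$ does not split. -/

import Mathlib

open scoped Matrix

namespace SlantedQuadrangle

/-! ### The slanted symplectic quadrangle over a field -/

section Quadrangle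

variable (F : Type*) [Field F]

/-- The matrix `M(x, y, z)`. -/
def slantedMatrix {F : Type*} [Field F] (x y z : F) : Matrix (Fin 4) (Fin 4) F :=
  !![1, -x, y, z;
     0,  1, 0, y;
     0,  0, 1, x;
     0,  0, 0, 1]

theorem det_slantedMatrix {F : Type*} [Field F] (x y z : F) : (slantedMatrix x y z).det = 1 := by
  simp [slantedMatrix, Matrix.det_succ_row_zero, Fin.sum_univ_succ]

theorem slantedMatrix_mul {F : Type*} [Field F] (x y z x' y' z' : F) :
    slantedMatrix x y z * slantedMatrix x' y' z' =
      slantedMatrix (x + x') (y + y') (z + z' + y * x' - x * y') := by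
  ext i j
  fin_cases i <;> fin_cases j <;>
    simp [slantedMatrix, Matrix.mul_apply, Fin.sum_univ_succ] <;> ring

theorem slantedMatrix_zero {F : Type*} [Field F] : slantedMatrix (0 : F) 0 0 = 1 := by
  ext i j
  fin_cases i <;> fin_cases j <;> simp [slantedMatrix]

/-- `M(x, y, z)` as an element of `SL₄(F)`. -/
def slantedSL {F : Type*} [Field F] (x y z : F) : Matrix.SpecialLinearGroup (Fin 4) F :=
  ⟨slantedMatrix x y z, det_slantedMatrix x y z⟩

theorem slantedSL_mul {F : Type*} [Field F] (x y z x' y' z' : F) :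
    slantedSL x y z * slantedSL x' y' z' =
      slantedSL (x + x') (y + y') (z + z' + y * x' - x * y') :=
  Subtype.ext (slantedMatrix_mul x y z x' y' z')

theorem slantedSL_zero {F : Type*} [Field F] : slantedSL (0 : F) 0 0 = 1 :=
  Subtype.ext slantedMatrix_zero

theorem slantedSL_inv {F : Type*} [Field F] (x y z : F) :
    (slantedSL x y z)⁻¹ = slantedSL (-x) (-y) (-z) := by
  rw [inv_eq_iff_mul_eq_one, slantedSL_mul, ← slantedSL_zero]
  congr 1 <;> ring

/-- The group `S = {M(x, y, z) | x, y, z ∈ F} ≤ SL₄(F)`. -/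
def slantedGroup : Subgroup (Matrix.SpecialLinearGroup (Fin 4) F) where
  carrier := {g | ∃ x y z : F, g = slantedSL x y z}
  mul_mem' := by
    rintro _ _ ⟨x, y, z, rfl⟩ ⟨x', y', z', rfl⟩
    exact ⟨_, _, _, slantedSL_mul x y z x' y' z'⟩
  one_mem' := ⟨0, 0, 0, slantedSL_zero.symm⟩
  inv_mem' := by
    rintro _ ⟨x, y, z, rfl⟩
    exact ⟨_, _, _, slantedSL_inv x y z⟩

/-- `M(x, y, z)` as an element of `S`. -/
def slantedElt {F : Type*} [Field F] (x y z : F) : slantedGroup F :=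
  ⟨slantedSL x y z, x, y, z, rfl⟩

theorem slantedElt_mul {F : Type*} [Field F] (x y z x' y' z' : F) :
    slantedElt x y z * slantedElt x' y' z' =
      slantedElt (x + x') (y + y') (z + z' + y * x' - x * y') :=
  Subtype.ext (slantedSL_mul x y z x' y' z')

theorem slantedElt_zero {F : Type*} [Field F] : slantedElt (0 : F) 0 0 = 1 :=
  Subtype.ext slantedSL_zero

theorem slantedElt_inv {F : Type*} [Field F] (x y z : F) :
    (slantedElt x y z)⁻¹ = slantedElt (-x) (-y) (-z) :=
  Subtype.ext (slantedSL_inv x y z)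

/-- The subgroup `X₀ = {M(0, 0, μ) | μ ∈ F}` of `S`. -/
def centralSubgroup : Subgroup (slantedGroup F) where
  carrier := {g | ∃ μ : F, g = slantedElt 0 0 μ}
  mul_mem' := by
    rintro _ _ ⟨μ, rfl⟩ ⟨ν, rfl⟩
    refine ⟨μ + ν, ?_⟩
    rw [slantedElt_mul]
    congr 1 <;> ring
  one_mem' := ⟨0, slantedElt_zero.symm⟩
  inv_mem' := by
    rintro _ ⟨μ, rfl⟩
    refine ⟨-μ, ?_⟩
    rw [slantedElt_inv]
    congr 1 <;> ring

/-- The subgroup `X_[a:b] = {M(μa, μb, 0) | μ ∈ F}` of `S`. -/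
def directionSubgroup {F : Type*} [Field F] (a b : F) : Subgroup (slantedGroup F) where
  carrier := {g | ∃ μ : F, g = slantedElt (μ * a) (μ * b) 0}
  mul_mem' := by
    rintro _ _ ⟨μ, rfl⟩ ⟨ν, rfl⟩
    refine ⟨μ + ν, ?_⟩
    rw [slantedElt_mul]
    congr 1 <;> ring
  one_mem' := ⟨0, by simp [slantedElt_zero]⟩
  inv_mem' := by
    rintro _ ⟨μ, rfl⟩
    refine ⟨-μ, ?_⟩
    rw [slantedElt_inv]
    congr 1 <;> ring

/-- `X` is one of the subgroups `X₀` and `X_[a:b]`, where `[a:b]` is a point of the projective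
line over `F`. -/
def IsLineSubgroup {F : Type*} [Field F] (X : Subgroup (slantedGroup F)) : Prop :=
  X = centralSubgroup F ∨ ∃ a b : F, (a, b) ≠ (0, 0) ∧ X = directionSubgroup a b

/-- The lines: the left cosets in `S` of the subgroups `X₀` and `X_[a:b]`. -/
def SlantedLine : Type _ :=
  {L : Set (slantedGroup F) // ∃ X : Subgroup (slantedGroup F), IsLineSubgroup X ∧
    ∃ g : slantedGroup F, L = (fun h => g * h) '' (X : Set (slantedGroup F))}

/-- The slanted symplectic quadrangle `W^◇(F)`, as the incidence graph of the geometry whose points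
are the elements of `S`, whose lines are the cosets above, and whose incidence is membership. -/
def slantedQuadrangle : SimpleGraph (slantedGroup F ⊕ SlantedLine F) where
  Adj
    | .inl p, .inr L => p ∈ L.1
    | .inr L, .inl p => p ∈ L.1
    | _, _ => False
  symm := ⟨by rintro (p | L) (q | K) h <;> exact h⟩
  loopless := ⟨by rintro (p | L) h <;> exact h⟩

end Quadrangle

/-! ### Regular actions -/

/-- A group `H` of automorphisms of an incidence graph acts regularly on the chambers
(i.e. on the edges of the graph). -/
def IsChamberRegular {W : Type*} {G : SimpleGraph W} (H : Subgroup (G ≃g G)) : Prop :=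
  ∀ c ∈ G.edgeSet, ∀ d ∈ G.edgeSet, ∃! g : G ≃g G, g ∈ H ∧ Sym2.map g c = d

/-- Two subgroups are conjugate in the ambient group. -/
def AreConjugate {Γ : Type*} [Group Γ] (H K : Subgroup Γ) : Prop :=
  ∃ g : Γ, K = H.map (MulAut.conj g).toMonoidHom

/-! ### Affine groups over `𝔽₂` -/

/-- The vector space `V = 𝔽₂⁶` (column vectors). -/
abbrev V : Type := Fin 6 → ZMod 2

/-- The action of `GL₆(𝔽₂)` on the (multiplicatively written) group `V` by left multiplication. -/
def linearAction : GL (Fin 6) (ZMod 2) →* MulAut (Multiplicative V) where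
  toFun g :=
    { toFun := fun v => .ofAdd (g.val *ᵥ v.toAdd)
      invFun := fun v => .ofAdd (g⁻¹.val *ᵥ v.toAdd)
      left_inv := fun v => by
        simp only [toAdd_ofAdd, Matrix.mulVec_mulVec, ← Units.val_mul, inv_mul_cancel,
          Units.val_one, Matrix.one_mulVec, ofAdd_toAdd]
      right_inv := fun v => by
        simp only [toAdd_ofAdd, Matrix.mulVec_mulVec, ← Units.val_mul, mul_inv_cancel,
          Units.val_one, Matrix.one_mulVec, ofAdd_toAdd]
      map_mul' := fun v w => by
        simp only [toAdd_mul, Matrix.mulVec_add, ofAdd_add] }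
  map_one' := by
    ext1 v
    simp
  map_mul' g h := by
    ext1 v
    simp [Matrix.mulVec_mulVec]

/-- The affine group `V ⋊ GL₆(𝔽₂)`. -/
abbrev AGL : Type := Multiplicative V ⋊[linearAction] GL (Fin 6) (ZMod 2)

/-- The subgroup `V ⋊ H` of the affine group, for `H ≤ GL₆(𝔽₂)`. -/
def affineGroup (H : Subgroup (GL (Fin 6) (ZMod 2))) : Subgroup AGL :=
  H.comap SemidirectProduct.rightHom

/-- The affine map `v ↦ h v + t` given by `(t, h) ∈ V ⋊ GL₆(𝔽₂)`. -/
def affineApply (f : AGL) (v : V) : V := f.right.val *ᵥ v + f.left.toAdd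

/-! ### The matrices -/

/-- The matrix `A`, as an invertible matrix. -/
def matA : GL (Fin 6) (ZMod 2) :=
  let M : Matrix (Fin 6) (Fin 6) (ZMod 2) :=
    !![0, 0, 1, 1, 1, 1;
       0, 0, 0, 1, 1, 0;
       1, 1, 1, 1, 1, 0;
       0, 1, 0, 1, 0, 1;
       0, 0, 1, 0, 1, 0;
       0, 0, 0, 1, 1, 1]
  ⟨M, M * M * M * M * M, by decide +kernel, by decide +kernel⟩

/-- The matrix `B`, as an invertible matrix. -/
def matB : GL (Fin 6) (ZMod 2) :=
  let M : Matrix (Fin 6) (Fin 6) (ZMod 2) :=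
    !![1, 0, 1, 1, 0, 1;
       1, 1, 0, 1, 1, 1;
       1, 1, 1, 1, 1, 0;
       0, 1, 0, 1, 0, 1;
       1, 1, 1, 0, 0, 1;
       1, 0, 0, 1, 1, 0]
  ⟨M, M, by decide +kernel, by decide +kernel⟩

/-- The matrix `C`, as an invertible matrix. -/
def matC : GL (Fin 6) (ZMod 2) :=
  let M : Matrix (Fin 6) (Fin 6) (ZMod 2) :=
    !![1, 1, 0, 1, 0, 0;
       1, 0, 1, 1, 0, 0;
       1, 1, 1, 1, 1, 0;
       1, 0, 1, 0, 1, 1;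
       0, 1, 1, 1, 0, 0;
       1, 0, 0, 1, 0, 0]
  ⟨M, M * M, by decide +kernel, by decide +kernel⟩

/-- The matrix `D`, as an invertible matrix. -/
def matD : GL (Fin 6) (ZMod 2) :=
  let M : Matrix (Fin 6) (Fin 6) (ZMod 2) :=
    !![0, 1, 0, 0, 0, 0;
       1, 1, 0, 0, 0, 0;
       0, 0, 0, 1, 0, 0;
       0, 0, 1, 1, 0, 0;
       0, 0, 0, 0, 1, 1;
       0, 0, 0, 0, 1, 0]
  ⟨M, M * M, by decide +kernel, by decide +kernel⟩

/-- The group `⟨A, C⟩`. -/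
def groupAC : Subgroup (GL (Fin 6) (ZMod 2)) := Subgroup.closure {matA, matC}

/-- The group `⟨A⟩`. -/
def groupA : Subgroup (GL (Fin 6) (ZMod 2)) := Subgroup.zpowers matA

/-- The group `⟨B, C⟩`. -/
def groupBC : Subgroup (GL (Fin 6) (ZMod 2)) := Subgroup.closure {matB, matC}

theorem matA_mem : matA ∈ groupAC := Subgroup.subset_closure (by simp)

theorem matC_mem : matC ∈ groupAC := Subgroup.subset_closure (by simp)

/-- The subspaces `U₁, …, U₆` of `V`, indexed by `0, …, 5`; coordinates are written in the standard
basis `e₁, …, e₆`. -/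
def U : Fin 6 → Submodule (ZMod 2) V :=
  ![Submodule.span (ZMod 2) {![0, 0, 0, 0, 1, 0], ![0, 0, 0, 0, 0, 1]},
    Submodule.span (ZMod 2) {![1, 0, 0, 0, 0, 0], ![0, 1, 0, 0, 0, 0]},
    Submodule.span (ZMod 2) {![0, 0, 1, 0, 0, 0], ![0, 0, 0, 1, 0, 0]},
    Submodule.span (ZMod 2) {![1, 0, 1, 0, 1, 0], ![0, 1, 0, 1, 1, 1]},
    Submodule.span (ZMod 2) {![1, 0, 0, 1, 0, 1], ![0, 1, 1, 1, 1, 0]},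
    Submodule.span (ZMod 2) {![0, 1, 1, 0, 0, 1], ![1, 1, 0, 1, 1, 0]}]

/-! ### The identification of the point set with `V` -/

/-- `Φ : S ≃ V` is the group isomorphism with the prescribed values on the six generators
`M(1,0,0), M(α,0,0), M(0,1,0), M(0,α,0), M(0,0,1), M(0,0,α)` (they go to `e₁, …, e₆`). -/
def IsCoordinateIso {F : Type*} [Field F] (α : F) (Φ : slantedGroup F ≃* Multiplicative V) : Prop :=
  Φ (slantedElt 1 0 0) = .ofAdd (Pi.single 0 1) ∧
  Φ (slantedElt α 0 0) = .ofAdd (Pi.single 1 1) ∧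
  Φ (slantedElt 0 1 0) = .ofAdd (Pi.single 2 1) ∧
  Φ (slantedElt 0 α 0) = .ofAdd (Pi.single 3 1) ∧
  Φ (slantedElt 0 0 1) = .ofAdd (Pi.single 4 1) ∧
  Φ (slantedElt 0 0 α) = .ofAdd (Pi.single 5 1)

/-- Given an identification `Θ` of `V ⋊ ⟨A, C⟩` with a group `Γ`, the subgroup of `Γ` corresponding
to `V ⋊ K`, for a subgroup `K` of `⟨A, C⟩`. -/
def affineImage {Γ : Type*} [Group Γ] (Θ : affineGroup groupAC ≃* Γ)
    (K : Subgroup (GL (Fin 6) (ZMod 2))) : Subgroup Γ :=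
  ((affineGroup K).subgroupOf (affineGroup groupAC)).map Θ.toMonoidHom

end SlantedQuadrangle

open SlantedQuadrangle

namespace SlantedQuadrangle

/-! In characteristic two, `M(x, y, z) ↦ (x, y, z + xy)` linearizes `S`. It turns the quadrangle
into an affine picture: points are the vectors of `V`, lines are the cosets of the six planes `U i`,
and any three of these planes are independent, so that `V` is their direct sum
(`planeVec_independent`).

Automorphisms are affine. A point lies on six lines and a line has four points, so automorphisms
send points to points (`exists_map_inl`) and act on `V` by permuting the cosets of the planes.
Independence of three planes, with the fact that there are fewer than `4 + 4` directions, forces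
parallel lines to have parallel images (`direction_add`). Parallelograms then go to parallelograms,
and the permutation is affine (`PreservesCosets.exists_affine`). Hence the automorphism group is `V
⋊ G`, where `G` is the group of linear maps permuting the planes.

The group `G` is `⟨A, C⟩`. Its image in `Sym(6)` is everything, already on words in `A` and `C`. A
map fixing every plane is a power of `D` (`InducesPerm.eq_matD_pow`), and `D` is itself such a word.
The extension does not split because `C` and a certain `T` have commuting images, while `T C = C D
T`; as `D` commutes with both, changing the lifts by powers of `D` cannot remove this obstruction.

Chamber-regular subgroups containing `V` correspond to the subgroups `K ≤ ⟨A, C⟩` that are regular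
on the six planes (`HasLinearPart.isChamberRegular_iff`), and conjugacy corresponds to conjugacy.
Such a `K` has order six, so it is generated by an involution `b` and an element `c` of order three,
with `b` centralizing or inverting `c`. In `Sym(6)` each case leaves one conjugacy class of
fixed-point-free pairs `(b, c)`; the ambiguity by powers of `D` in the lifts is then removed by
conjugating with `D` and `T`. The two cases give `⟨A⟩` and `⟨B, C⟩`, of which only the first is
abelian. -/

/-- The first spanning vector of each `U i`. -/
def spanFst : Fin 6 → V :=
  ![![0, 0, 0, 0, 1, 0], ![1, 0, 0, 0, 0, 0], ![0, 0, 1, 0, 0, 0],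
    ![1, 0, 1, 0, 1, 0], ![1, 0, 0, 1, 0, 1], ![0, 1, 1, 0, 0, 1]]

/-- The second spanning vector of each `U i`. -/
def spanSnd : Fin 6 → V :=
  ![![0, 0, 0, 0, 0, 1], ![0, 1, 0, 0, 0, 0], ![0, 0, 0, 1, 0, 0],
    ![0, 1, 0, 1, 1, 1], ![0, 1, 1, 1, 1, 0], ![1, 1, 0, 1, 1, 0]]

/-- The elements of `U i`, parametrized by `𝔽₂²`. -/
def planeVec (i : Fin 6) (s t : ZMod 2) : V := fun r => s * spanFst i r + t * spanSnd i r

theorem mem_U_iff {i : Fin 6} {v : V} : v ∈ U i ↔ ∃ s t, planeVec i s t = v := by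
  have h : U i = Submodule.span (ZMod 2) {spanFst i, spanSnd i} := by
    fin_cases i <;> rfl
  rw [h, Submodule.mem_span_pair]
  rfl

theorem planeVec_mem (i : Fin 6) (s t : ZMod 2) : planeVec i s t ∈ U i :=
  mem_U_iff.2 ⟨s, t, rfl⟩

/-- A plane has only four vectors, so membership is settled by running through the parameters; the
finite checks below evaluate this instance. -/
instance decidableMemU (i : Fin 6) (v : V) : Decidable (v ∈ U i) :=
  decidable_of_iff _ mem_U_iff.symm

/-- This is the geometric core: three lines of pairwise different directions never close up to a
triangle. -/
theorem planeVec_independent : ∀ i j k : Fin 6, i ≠ j → i ≠ k → j ≠ k → ∀ a b c d e f : ZMod 2,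
    planeVec i a b + planeVec j c d + planeVec k e f = 0 → a = 0 ∧ b = 0 := by
  decide +kernel

/-- Used together with the complementary triple of planes: any given index is missed by one of the
two triples. -/
theorem planeVec_span_low : ∀ v : V, ∃ a b c d e f : ZMod 2,
    v = planeVec 0 a b + planeVec 1 c d + planeVec 2 e f := by
  decide +kernel

theorem planeVec_span_high : ∀ v : V, ∃ a b c d e f : ZMod 2,
    v = planeVec 3 a b + planeVec 4 c d + planeVec 5 e f := by
  decide +kernel

theorem matA_U : ∀ (i : Fin 6) (v : V), v ∈ U i ↔
    matA.val *ᵥ v ∈ U ((List.formPerm [0, 4, 1, 2, 3, 5] : Equiv.Perm (Fin 6)) i) := by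
  decide +kernel

theorem matC_U : ∀ (i : Fin 6) (v : V), v ∈ U i ↔
    matC.val *ᵥ v ∈ U ((List.formPerm [0, 2, 4] * List.formPerm [1, 3, 5] :
      Equiv.Perm (Fin 6)) i) := by
  decide +kernel

/-! ### The permutation representation on the six planes and its kernel -/

/-- `g` maps each `U i` onto `U (π i)`. -/
def InducesPerm (g : GL (Fin 6) (ZMod 2)) (π : Equiv.Perm (Fin 6)) : Prop :=
  ∀ i v, v ∈ U i ↔ g.val *ᵥ v ∈ U (π i)

theorem eq_of_planeVec_mem : ∀ i j, planeVec i 1 0 ∈ U j → i = j := by decide +kernel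

theorem U_injective : Function.Injective U := fun i j h =>
  eq_of_planeVec_mem i j (h ▸ planeVec_mem i 1 0)

theorem InducesPerm.unique {g : GL (Fin 6) (ZMod 2)} {π ρ : Equiv.Perm (Fin 6)}
    (hπ : InducesPerm g π) (hρ : InducesPerm g ρ) : π = ρ := by
  ext1 i
  apply U_injective
  ext w
  have hw : g.val *ᵥ (g⁻¹.val *ᵥ w) = w := by
    rw [Matrix.mulVec_mulVec, ← Units.val_mul, mul_inv_cancel, Units.val_one, Matrix.one_mulVec]
  rw [← hw, ← hπ, ← hρ]

theorem InducesPerm.one : InducesPerm 1 1 := fun i v => by simp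

theorem InducesPerm.mul {g h : GL (Fin 6) (ZMod 2)} {π ρ : Equiv.Perm (Fin 6)}
    (hg : InducesPerm g π) (hh : InducesPerm h ρ) : InducesPerm (g * h) (π * ρ) := fun i v => by
  rw [hh, hg, Matrix.mulVec_mulVec, Units.val_mul, Equiv.Perm.mul_apply]

theorem InducesPerm.inv {g : GL (Fin 6) (ZMod 2)} {π : Equiv.Perm (Fin 6)}
    (hg : InducesPerm g π) : InducesPerm g⁻¹ π⁻¹ := fun i v => by
  rw [hg (π⁻¹ i), Matrix.mulVec_mulVec, ← Units.val_mul, mul_inv_cancel, Units.val_one,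
    Matrix.one_mulVec, ← Equiv.Perm.mul_apply, mul_inv_cancel, Equiv.Perm.one_apply]

/-- The group of linear maps that permute `U₁, …, U₆`. -/
def typeGroup : Subgroup (GL (Fin 6) (ZMod 2)) where
  carrier := {g | ∃ π, InducesPerm g π}
  mul_mem' := fun ⟨_, ha⟩ ⟨_, hb⟩ => ⟨_, ha.mul hb⟩
  one_mem' := ⟨1, .one⟩
  inv_mem' := fun ⟨_, ha⟩ => ⟨_, ha.inv⟩

theorem groupAC_le_typeGroup : groupAC ≤ typeGroup := by
  rw [groupAC, Subgroup.closure_le]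
  rintro _ (rfl | rfl)
  exacts [⟨_, matA_U⟩, ⟨_, matC_U⟩]

/-- The action of `⟨A, C⟩` on the indices of `U₁, …, U₆`. -/
noncomputable def typeHom : groupAC →* Equiv.Perm (Fin 6) :=
  MonoidHom.mk' (fun g => (groupAC_le_typeGroup g.2).choose) fun a b =>
    (groupAC_le_typeGroup (a * b).2).choose_spec.unique
      ((groupAC_le_typeGroup a.2).choose_spec.mul (groupAC_le_typeGroup b.2).choose_spec)

theorem inducesPerm_typeHom (g : groupAC) : InducesPerm g.1 (typeHom g) :=
  (groupAC_le_typeGroup g.2).choose_spec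

theorem typeHom_eq {g : groupAC} {π : Equiv.Perm (Fin 6)} (h : InducesPerm g.1 π) :
    typeHom g = π :=
  (inducesPerm_typeHom g).unique h

/-- `A` as an element of `⟨A, C⟩`. -/
def eltA : groupAC := ⟨matA, matA_mem⟩

/-- `C` as an element of `⟨A, C⟩`. -/
def eltC : groupAC := ⟨matC, matC_mem⟩

theorem typeHom_A : typeHom eltA = List.formPerm [0, 4, 1, 2, 3, 5] := typeHom_eq matA_U

theorem typeHom_C : typeHom eltC = List.formPerm [0, 2, 4] * List.formPerm [1, 3, 5] :=
  typeHom_eq matC_U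

/-- `D`, as a word in `A` and `C`. -/
def eltD : groupAC := eltA * eltC * eltA ^ 2 * eltC ^ 2 * eltA ^ 2 * eltC * eltA ^ 2 * eltC ^ 2 * eltA

theorem coe_eltD : (eltD : GL (Fin 6) (ZMod 2)) = matD := by
  show matA * matC * matA ^ 2 * matC ^ 2 * matA ^ 2 * matC * matA ^ 2 * matC ^ 2 * matA = matD
  decide +kernel

theorem orderOf_matD : orderOf matD = 3 :=
  orderOf_eq_prime (by decide +kernel) (by decide +kernel)

theorem matD_U : InducesPerm matD 1 := by
  have : ∀ (i : Fin 6) (v : V), v ∈ U i ↔ matD.val *ᵥ v ∈ U i := by decide +kernel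
  exact this

-- A linear map fixing every plane sends the basis vectors into `U 1`, `U 2` and `U 0`. Preservation
-- of the first spanning vectors of `U 3`, `U 4` and `U 5` already cuts the candidates down to the
-- powers of `D`, which is scaling of `x`, `y` by `α` and of `z + xy` by `α²`. The quantifiers are
-- interleaved with the constraints so that the search is pruned early.
set_option synthInstance.maxSize 100000 in
set_option synthInstance.maxHeartbeats 200000 in
set_option maxSynthPendingDepth 20 in
theorem columns_of_induces_one : ∀ x₁ : ZMod 2 × ZMod 2, x₁ ≠ 0 →
    ∀ x₃ x₅ : ZMod 2 × ZMod 2,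
      planeVec 1 x₁.1 x₁.2 + planeVec 2 x₃.1 x₃.2 + planeVec 0 x₅.1 x₅.2 ∈ U 3 →
    ∀ x₄ x₆ : ZMod 2 × ZMod 2,
      planeVec 1 x₁.1 x₁.2 + planeVec 2 x₄.1 x₄.2 + planeVec 0 x₆.1 x₆.2 ∈ U 4 →
    ∀ x₂ : ZMod 2 × ZMod 2,
      planeVec 1 x₂.1 x₂.2 + planeVec 2 x₃.1 x₃.2 + planeVec 0 x₆.1 x₆.2 ∈ U 5 →
    ∃ m : Fin 3, planeVec 1 x₁.1 x₁.2 = (matD ^ m.val).val *ᵥ planeVec 1 1 0 ∧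
      planeVec 1 x₂.1 x₂.2 = (matD ^ m.val).val *ᵥ planeVec 1 0 1 ∧
      planeVec 2 x₃.1 x₃.2 = (matD ^ m.val).val *ᵥ planeVec 2 1 0 ∧
      planeVec 2 x₄.1 x₄.2 = (matD ^ m.val).val *ᵥ planeVec 2 0 1 ∧
      planeVec 0 x₅.1 x₅.2 = (matD ^ m.val).val *ᵥ planeVec 0 1 0 ∧
      planeVec 0 x₆.1 x₆.2 = (matD ^ m.val).val *ᵥ planeVec 0 0 1 := by
  decide +kernel

theorem InducesPerm.eq_matD_pow {g : GL (Fin 6) (ZMod 2)} (hg : InducesPerm g 1) :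
    ∃ m : Fin 3, g = matD ^ m.val := by
  have h : ∀ i s t, ∃ x : ZMod 2 × ZMod 2, planeVec i x.1 x.2 = g.val *ᵥ planeVec i s t := by
    intro i s t
    obtain ⟨a, b, hab⟩ := mem_U_iff.1 ((hg i _).1 (planeVec_mem i s t))
    exact ⟨(a, b), hab⟩
  have hmem : ∀ i v, v ∈ U i → g.val *ᵥ v ∈ U i := fun i v => (hg i v).1
  obtain ⟨x₁, h₁⟩ := h 1 1 0
  obtain ⟨x₂, h₂⟩ := h 1 0 1
  obtain ⟨x₃, h₃⟩ := h 2 1 0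
  obtain ⟨x₄, h₄⟩ := h 2 0 1
  obtain ⟨x₅, h₅⟩ := h 0 1 0
  obtain ⟨x₆, h₆⟩ := h 0 0 1
  have hx : x₁ ≠ 0 := by
    rintro rfl
    have h0 : planeVec 1 0 0 = 0 := by decide
    have h1 : planeVec 1 1 0 ≠ 0 := by decide
    apply h1
    have hinj := Matrix.mulVec_injective_of_isUnit g.isUnit
    exact hinj (by simpa [h0] using h₁.symm)
  obtain ⟨m, e₁, e₂, e₃, e₄, e₅, e₆⟩ := columns_of_induces_one x₁ hx x₃ x₅
    (by rw [h₁, h₃, h₅, ← Matrix.mulVec_add, ← Matrix.mulVec_add]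
        exact hmem _ _ (by decide +kernel)) x₄ x₆
    (by rw [h₁, h₄, h₆, ← Matrix.mulVec_add, ← Matrix.mulVec_add]
        exact hmem _ _ (by decide +kernel)) x₂
    (by rw [h₂, h₃, h₆, ← Matrix.mulVec_add, ← Matrix.mulVec_add]
        exact hmem _ _ (by decide +kernel))
  rw [h₁] at e₁
  rw [h₂] at e₂
  rw [h₃] at e₃
  rw [h₄] at e₄
  rw [h₅] at e₅
  rw [h₆] at e₆
  refine ⟨m, Units.ext (Matrix.ext_of_mulVec_single fun j => ?_)⟩
  have hj : (Pi.single j 1 : V) = ![planeVec 1 1 0, planeVec 1 0 1, planeVec 2 1 0,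
      planeVec 2 0 1, planeVec 0 1 0, planeVec 0 0 1] j := by
    revert j
    decide +kernel
  rw [hj]
  fin_cases j
  exacts [e₁, e₂, e₃, e₄, e₅, e₆]

theorem typeHom_D : typeHom eltD = 1 := typeHom_eq (coe_eltD ▸ matD_U)

theorem typeHom_surjective : Function.Surjective typeHom := by
  rw [← MonoidHom.range_eq_top, eq_top_iff]
  have hc : (List.formPerm [0, 4, 1, 2, 3, 5] : Equiv.Perm (Fin 6)).IsCycle :=
    List.isCycle_formPerm (by decide) (by decide)
  have hs : (List.formPerm [0, 4, 1, 2, 3, 5] : Equiv.Perm (Fin 6)).support = Finset.univ := by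
    decide +kernel
  -- A 6-cycle and a transposition of two consecutive points generate `Sym(6)`; the word in `A` and
  -- `C` below maps to the transposition `(0 4)`.
  rw [← Equiv.Perm.closure_cycle_adjacent_swap hc hs 0, Subgroup.closure_le]
  rintro _ (rfl | rfl)
  · exact ⟨eltA, typeHom_A⟩
  · refine ⟨eltC ^ 2 * eltA * eltC * eltA ^ 4, ?_⟩
    simp only [map_mul, map_pow, typeHom_A, typeHom_C]
    decide +kernel

theorem exists_eq_mul_D_pow {g h : groupAC} (hgh : typeHom g = typeHom h) :
    ∃ m : Fin 3, g = h * eltD ^ m.val := by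
  have h1 : typeHom (h⁻¹ * g) = 1 := by rw [map_mul, map_inv, hgh, inv_mul_cancel]
  have h2 := inducesPerm_typeHom (h⁻¹ * g)
  rw [h1] at h2
  obtain ⟨m, hm⟩ := h2.eq_matD_pow
  refine ⟨m, ?_⟩
  have : h⁻¹ * g = eltD ^ m.val := Subtype.ext (by rw [hm, Subgroup.coe_pow, coe_eltD])
  rw [← this, mul_inv_cancel_left]

/-- By surjectivity, any map permuting the planes agrees with an element of `⟨A, C⟩` up to a power
of `D`, and `D` lies in `⟨A, C⟩`. -/
theorem typeGroup_eq : typeGroup = groupAC := by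
  refine le_antisymm ?_ groupAC_le_typeGroup
  rintro g ⟨π, hg⟩
  obtain ⟨h, rfl⟩ := typeHom_surjective π
  have h1 := (inducesPerm_typeHom h).inv.mul hg
  rw [inv_mul_cancel] at h1
  obtain ⟨m, hm⟩ := h1.eq_matD_pow
  rw [inv_mul_eq_iff_eq_mul] at hm
  rw [hm]
  exact mul_mem h.2 (pow_mem (coe_eltD ▸ eltD.2) _)

theorem map_typeHom_ker : typeHom.ker.map groupAC.subtype = Subgroup.zpowers matD := by
  apply le_antisymm
  · rintro _ ⟨g, hg, rfl⟩
    obtain ⟨m, hm⟩ := exists_eq_mul_D_pow (g := g) (h := 1) (by rw [map_one]; exact hg)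
    rw [hm, one_mul, map_pow, Subgroup.coe_subtype, coe_eltD]
    exact Subgroup.npow_mem_zpowers _ _
  · rw [Subgroup.zpowers_le]
    exact ⟨eltD, typeHom_D, coe_eltD⟩

theorem map_U (g : groupAC) (i : Fin 6) :
    (U i).map (Matrix.mulVecLin g.1.val) = U (typeHom g i) := by
  ext w
  constructor
  · rintro ⟨v, hv, rfl⟩
    exact (inducesPerm_typeHom g i v).1 hv
  · intro hw
    have hw' : g.1.val *ᵥ (g.1⁻¹.val *ᵥ w) = w := by
      rw [Matrix.mulVec_mulVec, ← Units.val_mul, mul_inv_cancel, Units.val_one, Matrix.one_mulVec]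
    refine ⟨g.1⁻¹.val *ᵥ w, (inducesPerm_typeHom g i _).2 (by rwa [hw']), hw'⟩

/-! ### Non-splitting of the extension -/

/-- An element of `⟨A, C⟩` that centralizes `B` and satisfies `T C = C D T`. -/
def eltT : groupAC :=
  eltA * eltC ^ 2 * eltA * eltC * eltA ^ 2 * eltC ^ 2 * eltA * eltC * eltA

theorem eltT_mul_eltC : eltT * eltC = eltC * eltD * eltT := by
  apply Subtype.ext
  simp only [Subgroup.coe_mul, coe_eltD]
  show matA * matC ^ 2 * matA * matC * matA ^ 2 * matC ^ 2 * matA * matC * matA * matC =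
    matC * matD * (matA * matC ^ 2 * matA * matC * matA ^ 2 * matC ^ 2 * matA * matC * matA)
  decide +kernel

theorem eltC_mul_eltD : eltC * eltD = eltD * eltC := by
  apply Subtype.ext
  simp only [Subgroup.coe_mul, coe_eltD]
  show matC * matD = matD * matC
  decide +kernel

theorem eltT_mul_eltD : eltT * eltD = eltD * eltT := by
  apply Subtype.ext
  simp only [Subgroup.coe_mul, coe_eltD]
  show matA * matC ^ 2 * matA * matC * matA ^ 2 * matC ^ 2 * matA * matC * matA * matD =
    matD * (matA * matC ^ 2 * matA * matC * matA ^ 2 * matC ^ 2 * matA * matC * matA)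
  decide +kernel

theorem eltD_ne_one : eltD ≠ 1 := fun h => by
  have h1 := coe_eltD
  rw [h] at h1
  have : (1 : GL (Fin 6) (ZMod 2)) ≠ matD := by decide +kernel
  exact this h1

theorem not_split : ¬ ∃ s : Equiv.Perm (Fin 6) →* groupAC,
    typeHom.comp s = MonoidHom.id (Equiv.Perm (Fin 6)) := by
  rintro ⟨s, hs⟩
  have hs' : ∀ g, typeHom (s (typeHom g)) = typeHom g := fun g => DFunLike.congr_fun hs _
  obtain ⟨m, hm⟩ := exists_eq_mul_D_pow (hs' eltC)
  obtain ⟨n, hn⟩ := exists_eq_mul_D_pow (hs' eltT)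
  have hcomm : typeHom eltC * typeHom eltT = typeHom eltT * typeHom eltC := by
    rw [← map_mul typeHom eltT eltC, eltT_mul_eltC, map_mul, map_mul, typeHom_D, mul_one]
  have h1 := congrArg s hcomm
  rw [map_mul, map_mul, hm, hn] at h1
  have hC : Commute eltC (eltD ^ n.val) := Commute.pow_right eltC_mul_eltD _
  have hT : Commute eltT (eltD ^ m.val) := Commute.pow_right eltT_mul_eltD _
  have hD : Commute (eltD ^ m.val) (eltD ^ n.val) := Commute.pow_pow_self _ _ _
  -- The powers of `D` move to the right through `C` and `T`, so commuting lifts would make `C` and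
  -- `T` themselves commute.
  have h2 : eltC * eltT * (eltD ^ m.val * eltD ^ n.val) =
      eltT * eltC * (eltD ^ m.val * eltD ^ n.val) := by
    calc _ = eltC * (eltT * eltD ^ m.val) * eltD ^ n.val := by group
      _ = eltC * eltD ^ m.val * (eltT * eltD ^ n.val) := by rw [hT.eq]; group
      _ = eltT * eltD ^ n.val * (eltC * eltD ^ m.val) := h1
      _ = eltT * (eltD ^ n.val * eltC) * eltD ^ m.val := by group
      _ = eltT * eltC * (eltD ^ n.val * eltD ^ m.val) := by rw [← hC.eq]; group
      _ = _ := by rw [hD.eq]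
  have h3 := mul_right_cancel h2
  rw [eltT_mul_eltC, mul_assoc, ← eltT_mul_eltD, ← mul_assoc, left_eq_mul] at h3
  exact eltD_ne_one h3

/-! ### Permutations preserving the cosets of the planes are affine -/

/-- `f` maps the cosets of the `U i` to cosets of the `U j`. -/
def PreservesCosets (f : Equiv.Perm V) : Prop :=
  ∀ i v, ∃ j, ∀ w, w - v ∈ U i ↔ f w - f v ∈ U j

theorem U_independent {i j k : Fin 6} (hij : i ≠ j) (hik : i ≠ k) (hjk : j ≠ k) {a b c : V}
    (ha : a ∈ U i) (hb : b ∈ U j) (hc : c ∈ U k) (h : a + b + c = 0) : a = 0 := by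
  obtain ⟨s, t, rfl⟩ := mem_U_iff.1 ha
  obtain ⟨s', t', rfl⟩ := mem_U_iff.1 hb
  obtain ⟨s'', t'', rfl⟩ := mem_U_iff.1 hc
  obtain ⟨rfl, rfl⟩ := planeVec_independent i j k hij hik hjk _ _ _ _ _ _ h
  funext r
  simp [planeVec]

theorem eq_zero_of_mem_U {i j : Fin 6} (hij : i ≠ j) {a : V} (hi : a ∈ U i) (hj : a ∈ U j) :
    a = 0 := by
  obtain ⟨k, hik, hjk⟩ : ∃ k, i ≠ k ∧ j ≠ k := by
    clear hi hj hij
    decide +revert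
  exact U_independent hij hik hjk hi (neg_mem hj) (zero_mem (U k)) (by simp)

theorem planeVec_ne_zero (i : Fin 6) : planeVec i 1 0 ≠ 0 := by
  decide +kernel +revert

theorem planeVec_injective (i : Fin 6) :
    Function.Injective fun x : ZMod 2 × ZMod 2 => planeVec i x.1 x.2 := by
  have : ∀ i, ∀ x y : ZMod 2 × ZMod 2, planeVec i x.1 x.2 = planeVec i y.1 y.2 → x = y := by
    decide +kernel
  exact fun x y h => this i x y h

section Grid

variable {f : Equiv.Perm V} {J : V → Fin 6 → Fin 6}

/-- Here `J v i` is the direction of the image of `v + U i`. The lines `v + w + U i` and `v + u + U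
k` are distinct and meet in `v + u + w`; equal image directions would give them the same image. -/
theorem ne_of_crossing (hJ : ∀ i v w, w - v ∈ U i ↔ f w - f v ∈ U (J v i)) {i k : Fin 6}
    (hik : i ≠ k) (v : V) (u w : V) (hu : u ∈ U i) (hw : w ∈ U k) :
    J (v + w) i ≠ J (v + u) k := by
  intro h
  obtain ⟨u', hu', hne⟩ : ∃ u' ∈ U i, u ≠ u' := by
    by_cases h0 : u = 0
    · exact ⟨_, planeVec_mem i 1 0, fun h1 => planeVec_ne_zero i (h1 ▸ h0)⟩
    · exact ⟨0, zero_mem _, h0⟩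
  have h1 := (hJ i (v + w) (v + u' + w)).1 (by convert hu' using 1; abel)
  have h2 := (hJ i (v + w) (v + u + w)).1 (by convert hu using 1; abel)
  have h3 := (hJ k (v + u) (v + u + w)).1 (by convert hw using 1; abel)
  rw [h] at h1 h2
  have h4 : f (v + u' + w) - f (v + u) ∈ U (J (v + u) k) := by
    convert add_mem (sub_mem h1 h2) h3 using 1
    abel
  have h5 := sub_mem ((hJ k _ _).2 h4) hw
  have h6 := eq_zero_of_mem_U hik (a := u' - u) (sub_mem hu' hu) (by convert h5 using 1; abel)
  exact hne (sub_eq_zero.1 h6).symm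

/-- In the grid `v + U i + U k`, if two rows have parallel images then all columns do. The four
sides of an image quadrilateral sum to zero. The two row sides share a direction, so two different
column directions would give three independent ones, and a column side would vanish. -/
theorem crossing_step (hJ : ∀ i v w, w - v ∈ U i ↔ f w - f v ∈ U (J v i)) {i k : Fin 6}
    (hik : i ≠ k) (v : V) {u u' w w' : V} (hu : u ∈ U i) (hu' : u' ∈ U i) (hw : w ∈ U k)
    (hw' : w' ∈ U k) (hww : w ≠ w') (h : J (v + w) i = J (v + w') i) :
    J (v + u) k = J (v + u') k := by
  by_contra hne
  have key : ∀ {x y}, x ∈ U i → y ∈ U k → f (v + x + y) - f (v + y) ∈ U (J (v + y) i) :=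
    fun {x y} hx _ => (hJ i (v + y) (v + x + y)).1 (by convert hx using 1; abel)
  have key' : ∀ {x y}, x ∈ U i → y ∈ U k → f (v + x + y) - f (v + x) ∈ U (J (v + x) k) :=
    fun {x y} _ hy => (hJ k (v + x) (v + x + y)).1 (by convert hy using 1; abel)
  have ha := sub_mem (key hu hw) (key hu' hw)
  have hc := sub_mem (key hu' hw') (key hu hw')
  rw [← h] at hc
  have hb := sub_mem (key' hu' hw) (key' hu' hw')
  have hd := sub_mem (key' hu hw') (key' hu hw)
  have h0 := U_independent (fun e => hne e.symm) (ne_of_crossing hJ hik v u' w hu' hw).symm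
    (ne_of_crossing hJ hik v u w hu hw).symm hb hd (add_mem ha hc) (by abel)
  have h1 : f (v + u' + w) = f (v + u' + w') := by
    rw [← sub_eq_zero, ← h0]
    abel
  exact hww (add_left_cancel (f.injective h1))

/-- For `i = k` the line is unchanged. Otherwise, if two rows of the grid had non-parallel images,
`crossing_step` would make all four columns, and then all four rows, pairwise non-parallel. -/
theorem direction_add (hJ : ∀ i v w, w - v ∈ U i ↔ f w - f v ∈ U (J v i)) {k : Fin 6} (v : V)
    {w : V} (hw : w ∈ U k) : J (v + w) = J v := by
  funext i
  rcases eq_or_ne i k with rfl | hik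
  · by_contra hne
    have hm := planeVec_mem i 1 0
    have h1 := (hJ i (v + w) (v + w + planeVec i 1 0)).1 (by convert hm using 1; abel)
    have h2 := (hJ i v (v + w)).1 (by convert hw using 1; abel)
    have h3 := (hJ i v (v + w + planeVec i 1 0)).1 (by convert add_mem hw hm using 1; abel)
    have h4 := eq_zero_of_mem_U hne h1 (by convert sub_mem h3 h2 using 1; abel)
    have h5 := f.injective (sub_eq_zero.1 h4)
    exact planeVec_ne_zero i (add_eq_left.1 h5)
  · by_contra hne
    have h0 : (0 : V) ∈ U k := zero_mem _
    have hw0 : w ≠ 0 := by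
      rintro rfl
      simp at hne
    have ht : ∀ {u u'}, u ∈ U i → u' ∈ U i → J (v + u) k = J (v + u') k → u = u' := by
      intro u u' hu hu' e
      by_contra huu
      exact hne (by simpa using crossing_step hJ hik.symm v hw h0 hu hu' huu e)
    have hl : ∀ {x y}, x ∈ U k → y ∈ U k → J (v + x) i = J (v + y) i → x = y := by
      intro x y hx hy e
      by_contra hxy
      have hm := planeVec_mem i 1 0
      exact planeVec_ne_zero i (ht hm (zero_mem _)
        (crossing_step hJ hik v hm (zero_mem _) hx hy hxy e))
    -- Rows and columns also differ from each other in direction, so eight distinct directions would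
    -- have to fit among six.
    let F : (ZMod 2 × ZMod 2) ⊕ (ZMod 2 × ZMod 2) → Fin 6 :=
      Sum.elim (fun x => J (v + planeVec i x.1 x.2) k) (fun y => J (v + planeVec k y.1 y.2) i)
    have hF : Function.Injective F := by
      rintro (x | x) (y | y) hxy
      · exact congrArg _ (planeVec_injective i (ht (planeVec_mem _ _ _) (planeVec_mem _ _ _) hxy))
      · exact absurd hxy.symm
          (ne_of_crossing hJ hik v _ _ (planeVec_mem _ _ _) (planeVec_mem _ _ _))
      · exact absurd hxy
          (ne_of_crossing hJ hik v _ _ (planeVec_mem _ _ _) (planeVec_mem _ _ _))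
      · exact congrArg _ (planeVec_injective k (hl (planeVec_mem _ _ _) (planeVec_mem _ _ _) hxy))
    have hcard := Fintype.card_le_of_injective F hF
    revert hcard
    decide

end Grid

/-- Three planes other than `U i` already span `V`, so every vector is reached from `0` without
moving along `U i`. -/
theorem U_induction {p : V → Prop} (i : Fin 6) (h0 : p 0)
    (hadd : ∀ k, k ≠ i → ∀ v w, w ∈ U k → p v → p (v + w)) (v : V) : p v := by
  have key : ∀ a b c : Fin 6, a ≠ i → b ≠ i → c ≠ i → ∀ x ∈ U a, ∀ y ∈ U b, ∀ z ∈ U c,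
      p (x + y + z) := by
    intro a b c ha hb hc x hx y hy z hz
    exact hadd c hc _ _ hz (hadd b hb _ _ hy (by simpa using hadd a ha 0 x hx h0))
  have hi : (3 ≠ i ∧ 4 ≠ i ∧ 5 ≠ i) ∨ (0 ≠ i ∧ 1 ≠ i ∧ 2 ≠ i) := by
    clear hadd key
    decide +revert
  rcases hi with ⟨h3, h4, h5⟩ | ⟨h3, h4, h5⟩
  · obtain ⟨a, b, c, d, e, f, rfl⟩ := planeVec_span_high v
    exact key _ _ _ h3 h4 h5 _ (planeVec_mem _ _ _) _ (planeVec_mem _ _ _) _ (planeVec_mem _ _ _)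
  · obtain ⟨a, b, c, d, e, f, rfl⟩ := planeVec_span_low v
    exact key _ _ _ h3 h4 h5 _ (planeVec_mem _ _ _) _ (planeVec_mem _ _ _) _ (planeVec_mem _ _ _)

/-- A permutation that maps cosets of the `U i` to such cosets respects parallelism. -/
theorem PreservesCosets.exists_perm {f : Equiv.Perm V} (hf : PreservesCosets f) :
    ∃ π : Equiv.Perm (Fin 6), ∀ i v w, w - v ∈ U i ↔ f w - f v ∈ U (π i) := by
  choose J hJ using hf
  have hJ' : ∀ i v w, w - v ∈ U i ↔ f w - f v ∈ U (J i v) := hJ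
  have hconst : ∀ v i, J i v = J i 0 := by
    intro v
    refine U_induction (p := fun v => ∀ i, J i v = J i 0) 0 (fun _ => rfl) ?_ v
    intro k _ v w hw hv i
    rw [← hv]
    exact congrFun (direction_add (J := fun v i => J i v) hJ' v hw) i
  have hinj : Function.Injective fun i => J i 0 := by
    intro i i' h
    apply eq_of_planeVec_mem
    have h1 := (hJ i 0 (planeVec i 1 0)).1 (by simpa using planeVec_mem i 1 0)
    have h2 : J i 0 = J i' 0 := h
    rw [h2] at h1
    simpa using (hJ i' 0 _).2 h1
  refine ⟨Equiv.ofBijective _ (Finite.injective_iff_bijective.1 hinj), fun i v w => ?_⟩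
  rw [hJ i v w, hconst]
  rfl

/-- A permutation that maps cosets of the `U i` to such cosets is affine. -/
theorem PreservesCosets.exists_affine {f : Equiv.Perm V} (hf : PreservesCosets f) :
    ∃ g : groupAC, ∀ v, f v = g.1.val *ᵥ v + f 0 := by
  obtain ⟨π, hπ⟩ := hf.exists_perm
  have hstep : ∀ i v u, u ∈ U i → f (v + u) - f v = f u - f 0 := by
    intro i v u hu
    refine U_induction (p := fun v => f (v + u) - f v = f u - f 0) i (by simp) ?_ v
    intro k hk v w hw hv
    rw [← hv]
    have h1 := (hπ i (v + w) (v + w + u)).1 (by convert hu using 1; abel)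
    have h2 := (hπ i v (v + u)).1 (by convert hu using 1; abel)
    have h3 := (hπ k (v + u) (v + w + u)).1 (by convert hw using 1; abel)
    have h4 := (hπ k v (v + w)).1 (by convert hw using 1; abel)
    -- The defect of the image parallelogram lies in the two different planes `U (π i)` and `U (π
    -- k)`; this is why the induction must avoid `i`.
    have h5 := eq_zero_of_mem_U (fun e => hk (π.injective e).symm) (sub_mem h1 h2)
      (by convert sub_mem h3 h4 using 1; abel)
    exact sub_eq_zero.1 h5
  have hadd : ∀ u v, f (v + u) - f v = f u - f 0 := by
    intro u
    refine U_induction (p := fun u => ∀ v, f (v + u) - f v = f u - f 0) 0 (fun v => by simp) ?_ u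
    intro k _ u w hw hu v
    have h1 := hstep k (v + u) w hw
    have h2 := hstep k u w hw
    have h3 := hu v
    rw [← add_assoc]
    calc f (v + u + w) - f v = (f (v + u + w) - f (v + u)) + (f (v + u) - f v) := by abel
      _ = (f (u + w) - f u) + (f u - f 0) := by rw [h1, h2, h3]
      _ = _ := by abel
  let L : V →ₗ[ZMod 2] V := AddMonoidHom.toZModLinearMap 2
    { toFun := fun v => f v - f 0
      map_zero' := sub_self _
      map_add' := fun v u => by
        show f (v + u) - f 0 = (f v - f 0) + (f u - f 0)
        rw [← hadd u v]
        abel }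
  have hL : ∀ v, L v = f v - f 0 := fun _ => rfl
  have hLinj : Function.Injective L := fun v w h => by
    rw [hL, hL, sub_left_inj] at h
    exact f.injective h
  have hmul : ∀ v, LinearMap.toMatrix' L *ᵥ v = f v - f 0 := fun v => by
    rw [LinearMap.toMatrix'_mulVec, hL]
  have hunit : IsUnit (LinearMap.toMatrix' L) := by
    rw [← Matrix.mulVec_injective_iff_isUnit]
    intro v w h
    exact hLinj (by rw [hL, hL, ← hmul, ← hmul]; exact h)
  obtain ⟨g, hg⟩ := hunit
  have hgv : ∀ v, g.val *ᵥ v = f v - f 0 := fun v => by rw [hg, hmul]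
  have hmem : g ∈ typeGroup := ⟨π, fun i v => by rw [hgv, ← hπ, sub_zero]⟩
  rw [typeGroup_eq] at hmem
  exact ⟨⟨g, hmem⟩, fun v => by rw [hgv, sub_add_cancel]⟩

/-! ### Subgroups regular on the six planes -/

/-- `K ≤ ⟨A, C⟩` permutes `U₁, …, U₆` regularly. -/
def IsTypeRegular (K : Subgroup groupAC) : Prop :=
  ∀ i j, ∃! k : groupAC, k ∈ K ∧ typeHom k i = j

theorem IsTypeRegular.eq_one {K : Subgroup groupAC} (hK : IsTypeRegular K) {k : groupAC}
    (hk : k ∈ K) {i : Fin 6} (h : typeHom k i = i) : k = 1 :=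
  (hK i i).unique ⟨hk, h⟩ ⟨one_mem K, by simp⟩

/-- An element of either group is determined by where it sends the index `0`, and the smaller group
already realizes every value. -/
theorem IsTypeRegular.eq_of_le {K L : Subgroup groupAC} (hK : IsTypeRegular K)
    (hL : IsTypeRegular L) (h : K ≤ L) : K = L := by
  refine le_antisymm h fun l hl => ?_
  obtain ⟨k, ⟨hk, hkl⟩, -⟩ := hK 0 (typeHom l 0)
  rwa [(hL 0 (typeHom l 0)).unique ⟨hl, rfl⟩ ⟨h hk, hkl⟩]

theorem IsTypeRegular.map_conj {K : Subgroup groupAC} (hK : IsTypeRegular K) (g : groupAC) :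
    IsTypeRegular (K.map (MulAut.conj g).toMonoidHom) := by
  intro i j
  obtain ⟨k, ⟨hk, hkj⟩, huniq⟩ := hK ((typeHom g)⁻¹ i) ((typeHom g)⁻¹ j)
  refine ⟨g * k * g⁻¹, ⟨⟨k, hk, rfl⟩, ?_⟩, ?_⟩
  · rw [map_mul, map_mul, map_inv, Equiv.Perm.mul_apply, Equiv.Perm.mul_apply, hkj,
      ← Equiv.Perm.mul_apply, mul_inv_cancel, Equiv.Perm.one_apply]
  rintro _ ⟨⟨l, hl, rfl⟩, h⟩
  have : l = k := huniq l ⟨hl, by rw [← h]; simp⟩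
  rw [this]
  rfl

theorem IsTypeRegular.card {K : Subgroup groupAC} (hK : IsTypeRegular K) : Nat.card K = 6 := by
  have : Function.Bijective fun k : K => typeHom k 0 := by
    refine ⟨fun k l h => Subtype.ext ((hK 0 _).unique ⟨k.2, rfl⟩ ⟨l.2, h.symm⟩), fun j => ?_⟩
    obtain ⟨k, ⟨hk, hkj⟩, -⟩ := hK 0 j
    exact ⟨⟨k, hk⟩, hkj⟩
  rw [Nat.card_eq_of_bijective _ this, Nat.card_fin]

theorem isTypeRegular_of_enum {K : Subgroup groupAC} (e : Fin 6 → groupAC) (he : ∀ n, e n ∈ K)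
    (hK : ∀ k ∈ K, ∃ n, k = e n) 
    (h : ∀ i j, ∃ n, typeHom (e n) i = j ∧ ∀ m, typeHom (e m) i = j → m = n) : IsTypeRegular K := by
  intro i j
  obtain ⟨n, hn, huniq⟩ := h i j
  refine ⟨e n, ⟨he n, hn⟩, ?_⟩
  rintro _ ⟨hk, hkj⟩
  obtain ⟨m, rfl⟩ := hK _ hk
  rw [huniq m hkj]

/-- `B`, as a word in `A` and `C`. -/
def eltB : groupAC := eltA ^ 3 * eltC ^ 2 * eltA ^ 3 * eltC * eltA ^ 3

theorem coe_eltB : (eltB : GL (Fin 6) (ZMod 2)) = matB := by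
  show matA ^ 3 * matC ^ 2 * matA ^ 3 * matC * matA ^ 3 = matB
  decide +kernel

theorem coe_eltC : (eltC : GL (Fin 6) (ZMod 2)) = matC := rfl

theorem coe_eltA : (eltA : GL (Fin 6) (ZMod 2)) = matA := rfl

theorem coe_eltT : (eltT : GL (Fin 6) (ZMod 2)) =
    matA * matC ^ 2 * matA * matC * matA ^ 2 * matC ^ 2 * matA * matC * matA := rfl

theorem typeHom_B : typeHom eltB = List.formPerm [0, 5] * List.formPerm [1, 4] *
    List.formPerm [2, 3] := by
  simp only [eltB, map_mul, map_pow, typeHom_A, typeHom_C]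
  decide +kernel

theorem groupA_le : groupA ≤ groupAC := (Subgroup.zpowers_le).2 matA_mem

theorem groupBC_le : groupBC ≤ groupAC := by
  rw [groupBC, Subgroup.closure_le]
  rintro _ (rfl | rfl)
  exacts [coe_eltB ▸ eltB.2, matC_mem]

theorem mem_groupA_iff {g : groupAC} : g ∈ groupA.subgroupOf groupAC ↔ g ∈ Subgroup.zpowers eltA := by
  rw [Subgroup.mem_subgroupOf, groupA, Subgroup.mem_zpowers_iff, Subgroup.mem_zpowers_iff]
  simp only [Subtype.ext_iff, Subgroup.coe_zpow, coe_eltA]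

theorem eltA_pow_six : eltA ^ 6 = 1 := by
  apply Subtype.ext
  show matA ^ 6 = 1
  decide +kernel

theorem isTypeRegular_groupA : IsTypeRegular (groupA.subgroupOf groupAC) := by
  refine isTypeRegular_of_enum (fun n => eltA ^ n.val)
    (fun n => mem_groupA_iff.2 (Subgroup.npow_mem_zpowers _ _)) (fun k hk => ?_) ?_
  · obtain ⟨n, rfl⟩ := Subgroup.mem_zpowers_iff.1 (mem_groupA_iff.1 hk)
    have h0 : 0 ≤ n % 6 := Int.emod_nonneg _ (by norm_num)
    have h6 : n % 6 < 6 := Int.emod_lt_of_pos _ (by norm_num)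
    refine ⟨⟨(n % 6).toNat, by omega⟩, ?_⟩
    have h1 : ((n % 6).toNat : ℤ) = n % 6 := Int.toNat_of_nonneg h0
    show eltA ^ n = eltA ^ (n % 6).toNat
    rw [← zpow_natCast, h1]
    conv_lhs => rw [← Int.emod_add_mul_ediv n 6, zpow_add, zpow_mul]
    have h2 : eltA ^ (6 : ℤ) = 1 := by exact_mod_cast eltA_pow_six
    rw [h2, one_zpow, mul_one]
  · simp only [map_pow, typeHom_A]
    decide +kernel

theorem isTypeRegular_groupBC : IsTypeRegular (groupBC.subgroupOf groupAC) := by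
  have hB : matB ∈ groupBC := Subgroup.subset_closure (by simp)
  have hC : matC ∈ groupBC := Subgroup.subset_closure (by simp)
  -- The six products `C ^ a * B ^ b` with `a < 3` and `b < 2` are closed under left multiplication
  -- by the generators and their inverses.
  have henum : ∀ g ∈ groupBC, ∃ n : Fin 6, g = matC ^ (n.val / 2) * matB ^ (n.val % 2) := by
    intro g hg
    induction hg using Subgroup.closure_induction_left with
    | one => exact ⟨0, by simp⟩
    | mul_left x hx y hy ih =>
      clear hy
      obtain ⟨n, rfl⟩ := ih
      rcases hx with rfl | rfl
      · revert n
        decide +kernel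
      · revert n
        decide +kernel
    | inv_mul_cancel x hx y hy ih =>
      clear hy
      obtain ⟨n, rfl⟩ := ih
      rcases hx with rfl | rfl
      · revert n
        decide +kernel
      · revert n
        decide +kernel
  refine isTypeRegular_of_enum (fun n => eltC ^ (n.val / 2) * eltB ^ (n.val % 2))
    (fun n => ?_) (fun k hk => ?_) ?_
  · rw [Subgroup.mem_subgroupOf, Subgroup.coe_mul, Subgroup.coe_pow, Subgroup.coe_pow, coe_eltB,
      coe_eltC]
    exact mul_mem (pow_mem hC _) (pow_mem hB _)
  · obtain ⟨n, hn⟩ := henum k hk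
    refine ⟨n, Subtype.ext ?_⟩
    rw [hn, Subgroup.coe_mul, Subgroup.coe_pow, Subgroup.coe_pow, coe_eltB, coe_eltC]
  · simp only [map_mul, map_pow, typeHom_B, typeHom_C]
    decide +kernel

/-- Fixed-point-free permutations of order three of six points are conjugate. -/
theorem isConj_of_pow_three {σ ρ : Equiv.Perm (Fin 6)} (hσ : σ ^ 3 = 1) (hρ : ρ ^ 3 = 1)
    (hσ' : ∀ i, σ i ≠ i) (hρ' : ∀ i, ρ i ≠ i) : IsConj σ ρ := by
  have key : ∀ σ : Equiv.Perm (Fin 6), σ ^ 3 = 1 → (∀ i, σ i ≠ i) → σ.cycleType = {3, 3} := by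
    intro σ h3 hfix
    have hord : orderOf σ = 3 := orderOf_eq_prime h3 fun h => hfix 0 (by simp [h])
    obtain ⟨n, hn⟩ := Equiv.Perm.cycleType_prime_order (hord ▸ Nat.prime_three)
    have hsupp : σ.support = Finset.univ := by
      ext i
      simp [hfix i]
    have hsum := σ.sum_cycleType
    rw [hn, hsupp, hord, Multiset.sum_replicate, Finset.card_univ, Fintype.card_fin,
      smul_eq_mul] at hsum
    have : n = 1 := by omega
    rw [hn, hord, this]
    rfl
  rw [Equiv.Perm.isConj_iff_cycleType_eq, key σ hσ hσ', key ρ hρ hρ']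

/-- Up to conjugacy in the centralizer of a fixed-point-free permutation of order three, there is
only one fixed-point-free involution commuting with it. -/
theorem exists_conj_of_commute {σ τ ρ : Equiv.Perm (Fin 6)}
    (hσ : ∀ i, σ i = ![1, 3, 5, 0, 2, 4] i) (hρ : ∀ i, ρ i = ![2, 5, 0, 4, 3, 1] i)
    (h2 : τ ^ 2 = 1) (hfix : ∀ i, τ i ≠ i) (hτ : τ * σ = σ * τ) :
    ∃ z : Equiv.Perm (Fin 6), z * σ = σ * z ∧ z * τ = ρ * z := by
  have hτ' : ∀ i, τ (σ i) = σ (τ i) := fun i => Equiv.congr_fun hτ i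
  have h1 : τ 1 = σ (τ 0) := by rw [← hτ', hσ]; rfl
  have h3 : τ 3 = σ (τ 1) := by rw [← hτ', hσ]; rfl
  have h5 : τ 5 = σ (τ 2) := by rw [← hτ', hσ]; rfl
  have h4 : τ 4 = σ (τ 5) := by rw [← hτ', hσ]; rfl
  let s : Fin 6 → Fin 6 := ![1, 3, 5, 0, 2, 4]
  -- The cycles of `σ` are `(0 1 3)` and `(2 5 4)`, so `τ` is determined by its values at `0` and
  -- `2`. The conjugators are powers of one cycle of `σ`, which centralize `σ`.
  have hval : ∀ i, τ i = ![τ 0, s (τ 0), τ 2, s (s (τ 0)), s (s (τ 2)), s (τ 2)] i := by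
    simp only [hσ] at h1 h3 h4 h5
    rw [h1] at h3
    rw [h5] at h4
    intro i
    fin_cases i
    exacts [rfl, h1, rfl, h3, h4, h5]
  have key : ∀ x y : Fin 6,
      (∀ i, ![x, s x, y, s (s x), s (s y), s y] (![x, s x, y, s (s x), s (s y), s y] i) = i) →
      (∀ i, ![x, s x, y, s (s x), s (s y), s y] i ≠ i) →
      ∃ n : Fin 3, ∀ i, (List.formPerm [0, 1, 3] ^ n.val : Equiv.Perm (Fin 6))
        (![x, s x, y, s (s x), s (s y), s y] i) =
        ![2, 5, 0, 4, 3, 1] ((List.formPerm [0, 1, 3] ^ n.val : Equiv.Perm (Fin 6)) i) := by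
    decide +kernel
  obtain ⟨n, hn⟩ := key (τ 0) (τ 2)
    (fun i => by rw [← hval, ← hval]; exact Equiv.congr_fun (pow_two τ ▸ h2) i)
    (fun i => by rw [← hval]; exact hfix i)
  refine ⟨List.formPerm [0, 1, 3] ^ n.val, ?_, ?_⟩
  · ext1 i
    rw [Equiv.Perm.mul_apply, Equiv.Perm.mul_apply, hσ, hσ]
    clear hn
    revert n i
    decide +kernel
  · ext1 i
    rw [Equiv.Perm.mul_apply, Equiv.Perm.mul_apply, hρ, hval]
    exact hn i

/-- Up to conjugacy in the centralizer of a fixed-point-free permutation of order three, there is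
only one fixed-point-free involution inverting it. -/
theorem exists_conj_of_inverts {σ τ ρ : Equiv.Perm (Fin 6)}
    (hσ : ∀ i, σ i = ![2, 3, 4, 5, 0, 1] i) (hρ : ∀ i, ρ i = ![5, 4, 3, 2, 1, 0] i)
    (h2 : τ ^ 2 = 1) (hfix : ∀ i, τ i ≠ i) (hτ : τ * σ = σ ^ 2 * τ) :
    ∃ z : Equiv.Perm (Fin 6), z * σ = σ * z ∧ z * τ = ρ * z := by
  have hτ' : ∀ i, τ (σ i) = σ (σ (τ i)) := fun i => Equiv.congr_fun (pow_two σ ▸ hτ) i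
  have h2 : τ 2 = σ (σ (τ 0)) := by rw [← hτ', hσ]; rfl
  have h4 : τ 4 = σ (σ (τ 2)) := by rw [← hτ', hσ]; rfl
  have h3 : τ 3 = σ (σ (τ 1)) := by rw [← hτ', hσ]; rfl
  have h5 : τ 5 = σ (σ (τ 3)) := by rw [← hτ', hσ]; rfl
  let s : Fin 6 → Fin 6 := ![2, 3, 4, 5, 0, 1]
  have hs : ∀ i, s (s (s (s i))) = s i := by decide
  -- The cycles of `σ` are `(0 2 4)` and `(1 3 5)`, so `τ` is determined by its values at `0` and
  -- `1`; again powers of one cycle suffice as conjugators.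
  have hval : ∀ i, τ i = ![τ 0, τ 1, s (s (τ 0)), s (s (τ 1)), s (τ 0), s (τ 1)] i := by
    simp only [hσ] at h2 h3 h4 h5
    rw [h2] at h4
    rw [h3] at h5
    intro i
    fin_cases i
    exacts [rfl, rfl, h2, h3, h4.trans (hs _), h5.trans (hs _)]
  have key : ∀ x y : Fin 6,
      (∀ i, ![x, y, s (s x), s (s y), s x, s y] (![x, y, s (s x), s (s y), s x, s y] i) = i) →
      (∀ i, ![x, y, s (s x), s (s y), s x, s y] i ≠ i) →
      ∃ n : Fin 3, ∀ i, (List.formPerm [0, 2, 4] ^ n.val : Equiv.Perm (Fin 6))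
        (![x, y, s (s x), s (s y), s x, s y] i) =
        ![5, 4, 3, 2, 1, 0] ((List.formPerm [0, 2, 4] ^ n.val : Equiv.Perm (Fin 6)) i) := by
    decide +kernel
  obtain ⟨n, hn⟩ := key (τ 0) (τ 1)
    (fun i => by rw [← hval, ← hval]; exact Equiv.congr_fun (pow_two τ ▸ ‹τ ^ 2 = 1›) i)
    (fun i => by rw [← hval]; exact hfix i)
  refine ⟨List.formPerm [0, 2, 4] ^ n.val, ?_, ?_⟩
  · ext1 i
    rw [Equiv.Perm.mul_apply, Equiv.Perm.mul_apply, hσ, hσ]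
    clear hn
    revert n i
    decide +kernel
  · ext1 i
    rw [Equiv.Perm.mul_apply, Equiv.Perm.mul_apply, hρ, hval]
    exact hn i

theorem typeHom_A_sq : ∀ i, typeHom (eltA ^ 2) i = ![1, 3, 5, 0, 2, 4] i := by
  rw [map_pow, typeHom_A]
  decide +kernel

theorem typeHom_A_cube : ∀ i, typeHom (eltA ^ 3) i = ![2, 5, 0, 4, 3, 1] i := by
  rw [map_pow, typeHom_A]
  decide +kernel

theorem typeHom_B_apply : ∀ i, typeHom eltB i = ![5, 4, 3, 2, 1, 0] i := by
  rw [typeHom_B]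
  decide +kernel

theorem typeHom_C_apply : ∀ i, typeHom eltC i = ![2, 3, 4, 5, 0, 1] i := by
  rw [typeHom_C]
  decide +kernel

theorem typeHom_A_sq_pow_three : typeHom (eltA ^ 2) ^ 3 = 1 := by
  rw [← map_pow, ← pow_mul, eltA_pow_six, map_one]

theorem typeHom_C_pow_three : typeHom eltC ^ 3 = 1 := by
  rw [typeHom_C]
  decide +kernel

/-- Cauchy gives elements of orders two and three; the subgroup of order three has index two, hence
is normal, so `b` either centralizes or inverts `c`. -/
theorem IsTypeRegular.exists_generators {K : Subgroup groupAC} (hK : IsTypeRegular K) :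
    ∃ b ∈ K, ∃ c ∈ K, b ^ 2 = 1 ∧ c ^ 3 = 1 ∧ b ≠ 1 ∧ c ≠ 1 ∧
      (b * c = c * b ∨ b * c = c ^ 2 * b) := by
  have hcard := hK.card
  have : Finite K := Nat.finite_of_card_ne_zero (by rw [hcard]; norm_num)
  have : Fact (Nat.Prime 3) := ⟨Nat.prime_three⟩
  obtain ⟨b, hb⟩ := exists_prime_orderOf_dvd_card' (G := K) 2 (by rw [hcard]; norm_num)
  obtain ⟨c, hc⟩ := exists_prime_orderOf_dvd_card' (G := K) 3 (by rw [hcard]; norm_num)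
  have hindex : (Subgroup.zpowers c).index = 2 := by
    have h := (Subgroup.zpowers c).card_mul_index
    rw [Nat.card_zpowers, hc, hcard] at h
    omega
  have hnormal := Subgroup.normal_of_index_eq_two hindex
  have hmem := hnormal.conj_mem c (Subgroup.mem_zpowers c) b
  have hc3 : c ^ 3 = 1 := by
    rw [← orderOf_dvd_iff_pow_eq_one, hc]
  have hb2 : b ^ 2 = 1 := by
    rw [← orderOf_dvd_iff_pow_eq_one, hb]
  have hc1 : c ≠ 1 := fun h => by simp [h] at hc
  have hb1 : b ≠ 1 := fun h => by simp [h] at hb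
  have hbc : b * c = c * b ∨ b * c = c ^ 2 * b := by
    obtain ⟨n, hn, hn'⟩ : ∃ n < 3, c ^ n = b * c * b⁻¹ := by
      simpa [hc] using mem_zpowers_iff_mem_range_orderOf.1 hmem
    interval_cases n
    · exact absurd hn'.symm (by simpa using hc1)
    · left
      rw [← mul_inv_eq_iff_eq_mul, ← hn', pow_one]
    · right
      rw [← mul_inv_eq_iff_eq_mul, ← hn']
  refine ⟨b, b.2, c, c.2, congrArg Subtype.val hb2, congrArg Subtype.val hc3,
    fun h => hb1 (Subtype.ext h), fun h => hc1 (Subtype.ext h), ?_⟩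
  exact hbc.imp (congrArg Subtype.val) (congrArg Subtype.val)

/-- The element `A ^ 3` inverts `D` and `A ^ 2` centralizes it. Thus commutation forces `c = A ^ 2`
exactly, and conjugation by a power of `D` corrects `b`. -/
theorem exists_conj_lift_A {b c : groupAC} (hb : typeHom b = typeHom (eltA ^ 3))
    (hc : typeHom c = typeHom (eltA ^ 2)) (hbc : b * c = c * b) :
    ∃ g : groupAC, g * b = eltA ^ 3 * g ∧ g * c = eltA ^ 2 * g := by
  obtain ⟨k, rfl⟩ := exists_eq_mul_D_pow hb
  obtain ⟨l, rfl⟩ := exists_eq_mul_D_pow hc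
  have key : ∀ k l : Fin 3,
      matA ^ 3 * matD ^ k.val * (matA ^ 2 * matD ^ l.val) =
        matA ^ 2 * matD ^ l.val * (matA ^ 3 * matD ^ k.val) →
      ∃ m : Fin 3, matD ^ m.val * (matA ^ 3 * matD ^ k.val) = matA ^ 3 * matD ^ m.val ∧
        matD ^ m.val * (matA ^ 2 * matD ^ l.val) = matA ^ 2 * matD ^ m.val := by
    decide +kernel
  obtain ⟨m, h₁, h₂⟩ := key k l (by
    simpa only [Subgroup.coe_mul, Subgroup.coe_pow, coe_eltA, coe_eltD] using
      congrArg Subtype.val hbc)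
  refine ⟨eltD ^ m.val, Subtype.ext ?_, Subtype.ext ?_⟩
  · simpa only [Subgroup.coe_mul, Subgroup.coe_pow, coe_eltA, coe_eltD] using h₁
  · simpa only [Subgroup.coe_mul, Subgroup.coe_pow, coe_eltA, coe_eltD] using h₂

/-- Conjugation by `T` multiplies `C` by `D`, which corrects `c`; conjugation by `D` fixes `C` and
corrects `b`, since `B` inverts `D`. -/
theorem exists_conj_lift_BC {b c : groupAC} (hb : typeHom b = typeHom eltB)
    (hc : typeHom c = typeHom eltC) :
    ∃ g : groupAC, g * b = eltB * g ∧ g * c = eltC * g := by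
  obtain ⟨k, rfl⟩ := exists_eq_mul_D_pow hb
  obtain ⟨l, rfl⟩ := exists_eq_mul_D_pow hc
  have key : ∀ k l : Fin 3, ∃ m n : Fin 3,
      matD ^ m.val * (matA * matC ^ 2 * matA * matC * matA ^ 2 * matC ^ 2 * matA * matC * matA) ^
        n.val * (matB * matD ^ k.val) = matB * (matD ^ m.val *
          (matA * matC ^ 2 * matA * matC * matA ^ 2 * matC ^ 2 * matA * matC * matA) ^ n.val) ∧
      matD ^ m.val * (matA * matC ^ 2 * matA * matC * matA ^ 2 * matC ^ 2 * matA * matC * matA) ^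
        n.val * (matC * matD ^ l.val) = matC * (matD ^ m.val *
          (matA * matC ^ 2 * matA * matC * matA ^ 2 * matC ^ 2 * matA * matC * matA) ^ n.val) := by
    decide +kernel
  obtain ⟨m, n, h₁, h₂⟩ := key k l
  refine ⟨eltD ^ m.val * eltT ^ n.val, Subtype.ext ?_, Subtype.ext ?_⟩
  · simpa only [Subgroup.coe_mul, Subgroup.coe_pow, coe_eltB, coe_eltD, coe_eltT] using h₁
  · simpa only [Subgroup.coe_mul, Subgroup.coe_pow, coe_eltC, coe_eltD, coe_eltT] using h₂

/-- First `c` is moved to `c₀` in `Sym(6)`, then `b` is adjusted inside the centralizer of `c₀`. The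
hypothesis `hb` passes on the conjugating element so that the relation between `b` and `c` can be
transported to `τ`. -/
theorem exists_conj_standard {b c b₀ c₀ : groupAC}
    (hc : IsConj (typeHom c) (typeHom c₀))
    (hb : ∀ τ, τ ^ 2 = 1 → (∀ i, τ i ≠ i) →
      (∃ g : groupAC, τ = typeHom (g * b * g⁻¹) ∧ typeHom (g * c * g⁻¹) = typeHom c₀) →
      ∃ z, z * typeHom c₀ = typeHom c₀ * z ∧ z * τ = typeHom b₀ * z)
    (hb2 : b ^ 2 = 1) (hfix : ∀ i, typeHom b i ≠ i) :
    ∃ g : groupAC, typeHom (g * b * g⁻¹) = typeHom b₀ ∧ typeHom (g * c * g⁻¹) = typeHom c₀ := by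
  obtain ⟨ρ, hρ⟩ := isConj_iff.1 hc
  obtain ⟨g, rfl⟩ := typeHom_surjective ρ
  have hgc : typeHom (g * c * g⁻¹) = typeHom c₀ := by rw [← hρ]; simp
  obtain ⟨z, hz, hz'⟩ := hb (typeHom (g * b * g⁻¹)) (by rw [← map_pow, conj_pow, hb2]; simp)
    (fun i h => hfix ((typeHom g)⁻¹ i) (by
      rw [Equiv.Perm.eq_inv_iff_eq]
      simpa using h)) ⟨g, rfl, hgc⟩
  obtain ⟨h, rfl⟩ := typeHom_surjective z
  refine ⟨h * g, ?_, ?_⟩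
  · rw [← mul_inv_eq_iff_eq_mul] at hz'
    rw [← hz']
    simp [mul_assoc]
  · rw [← hgc, ← mul_inv_eq_iff_eq_mul] at hz
    rw [← hgc, ← hz]
    simp [mul_assoc]

theorem mem_map_conj_mul {G : Type*} [Group G] {K : Subgroup G} {b g h x : G} (hb : b ∈ K)
    (hx : h * (g * b * g⁻¹) = x * h) : x ∈ K.map (MulAut.conj (h * g)).toMonoidHom := by
  rw [← mul_inv_eq_iff_eq_mul] at hx
  refine ⟨b, hb, ?_⟩
  rw [← hx]
  simp [mul_assoc]

/-- The subgroups of `⟨A, C⟩` that are regular on `U₁, …, U₆`, up to conjugacy. -/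
theorem IsTypeRegular.conj_groupA_or_groupBC {K : Subgroup groupAC} (hK : IsTypeRegular K) :
    AreConjugate K (groupA.subgroupOf groupAC) ∨ AreConjugate K (groupBC.subgroupOf groupAC) := by
  obtain ⟨b, hbK, c, hcK, hb2, hc3, hb1, hc1, hbc⟩ := hK.exists_generators
  have hbfix : ∀ i, typeHom b i ≠ i := fun i h => hb1 (hK.eq_one hbK h)
  have hcfix : ∀ i, typeHom c i ≠ i := fun i h => hc1 (hK.eq_one hcK h)
  have hc3' : typeHom c ^ 3 = 1 := by rw [← map_pow, hc3, map_one]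
  rcases hbc with hbc | hbc
  · left
    obtain ⟨g, hgb, hgc⟩ := exists_conj_standard (b := b) (c := c) (b₀ := eltA ^ 3)
      (c₀ := eltA ^ 2)
      (isConj_of_pow_three hc3' typeHom_A_sq_pow_three hcfix
        (fun i => by rw [typeHom_A_sq]; revert i; decide))
      (fun τ h2 hfix ⟨g, hτ, hg⟩ => by
        have : τ * typeHom (eltA ^ 2) = typeHom (eltA ^ 2) * τ := by
          rw [hτ, ← hg, ← map_mul, ← map_mul, conj_mul, conj_mul, hbc]
        exact exists_conj_of_commute typeHom_A_sq typeHom_A_cube h2 hfix this) hb2 hbfix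
    obtain ⟨h, hhb, hhc⟩ := exists_conj_lift_A hgb hgc (by rw [conj_mul, conj_mul, hbc])
    refine ⟨h * g, (isTypeRegular_groupA.eq_of_le (hK.map_conj _) ?_)⟩
    intro x hx
    have hbm : eltA ^ 3 ∈ K.map (MulAut.conj (h * g)).toMonoidHom :=
      mem_map_conj_mul hbK hhb
    have hcm : eltA ^ 2 ∈ K.map (MulAut.conj (h * g)).toMonoidHom :=
      mem_map_conj_mul hcK hhc
    have hA : eltA ^ 3 * (eltA ^ 2)⁻¹ = eltA := by rw [pow_succ', mul_inv_cancel_right]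
    have hAm := mul_mem hbm (inv_mem hcm)
    rw [hA] at hAm
    exact Subgroup.zpowers_le.2 hAm (mem_groupA_iff.1 hx)
  · right
    obtain ⟨g, hgb, hgc⟩ := exists_conj_standard (b := b) (c := c) (b₀ := eltB)
      (c₀ := eltC)
      (isConj_of_pow_three hc3' typeHom_C_pow_three hcfix
        (fun i => by rw [typeHom_C_apply]; revert i; decide))
      (fun τ h2 hfix ⟨g, hτ, hg⟩ => by
        have : τ * typeHom eltC = typeHom eltC ^ 2 * τ := by
          rw [hτ, ← hg, ← map_pow, ← map_mul, ← map_mul, conj_pow, conj_mul, conj_mul, hbc]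
        exact exists_conj_of_inverts typeHom_C_apply typeHom_B_apply h2 hfix this) hb2 hbfix
    obtain ⟨h, hhb, hhc⟩ := exists_conj_lift_BC hgb hgc
    refine ⟨h * g, (isTypeRegular_groupBC.eq_of_le (hK.map_conj _) ?_)⟩
    have hbm : eltB ∈ K.map (MulAut.conj (h * g)).toMonoidHom :=
      mem_map_conj_mul hbK hhb
    have hcm : eltC ∈ K.map (MulAut.conj (h * g)).toMonoidHom :=
      mem_map_conj_mul hcK hhc
    have hle : groupBC ≤ (K.map (MulAut.conj (h * g)).toMonoidHom).map groupAC.subtype := by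
      rw [groupBC, Subgroup.closure_le]
      rintro _ (rfl | rfl)
      exacts [⟨eltB, hbm, coe_eltB⟩, ⟨eltC, hcm, rfl⟩]
    intro x hx
    obtain ⟨y, hy, hyx⟩ := hle hx
    rwa [← Subtype.ext hyx]

/-! ### Coordinates over the field with four elements -/

section Coordinates

variable {F : Type*} [Field F]

theorem charTwo_of_card_eq_four (hF : Nat.card F = 4) : CharP F 2 := by
  have : Finite F := Nat.finite_of_card_ne_zero (by rw [hF]; norm_num)
  have := Fintype.ofFinite F
  have h4 : ((4 : ℕ) : F) = 0 := by
    rw [← hF, Nat.card_eq_fintype_card, FiniteField.cast_card_eq_zero]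
  have h2 : (2 : F) = 0 := by
    have : (2 : F) * 2 = 0 := by
      rw [← h4]
      norm_num
    simpa using this
  exact CharTwo.of_one_ne_zero_of_two_eq_zero one_ne_zero h2

theorem slantedElt_inj {x y z x' y' z' : F} :
    slantedElt x y z = slantedElt x' y' z' ↔ x = x' ∧ y = y' ∧ z = z' := by
  refine ⟨fun h => ?_, by rintro ⟨rfl, rfl, rfl⟩; rfl⟩
  have h1 : slantedMatrix x y z = slantedMatrix x' y' z' :=
    congrArg (fun g : slantedGroup F => (g : Matrix.SpecialLinearGroup (Fin 4) F).1) h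
  exact ⟨congrFun (congrFun h1 2) 3, congrFun (congrFun h1 0) 2, congrFun (congrFun h1 0) 3⟩

variable [CharP F 2] {α : F}

/-- The element `s + t α` of `F`. -/
def fieldElt (α : F) (s t : ZMod 2) : F :=
  ZMod.castHom (dvd_refl 2) F s + ZMod.castHom (dvd_refl 2) F t * α

theorem fieldElt_add (s t s' t' : ZMod 2) :
    fieldElt α s t + fieldElt α s' t' = fieldElt α (s + s') (t + t') := by
  simp only [fieldElt, map_add]
  ring

theorem fieldElt_zero : fieldElt α 0 0 = 0 := by simp [fieldElt]

theorem fieldElt_mul (hα : α ^ 2 + α + 1 = 0) (s t s' t' : ZMod 2) :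
    fieldElt α s t * fieldElt α s' t' =
      fieldElt α (s * s' + t * t') (s * t' + t * s' + t * t') := by
  simp only [fieldElt, map_add, map_mul]
  have h : α ^ 2 = α + 1 := by
    have h2 : (2 : F) = 0 := CharTwo.two_eq_zero
    linear_combination hα - (α + 1) * h2
  linear_combination
    (ZMod.castHom (dvd_refl 2) F t) * (ZMod.castHom (dvd_refl 2) F t') * h

theorem fieldElt_injective (hα : α ^ 2 + α + 1 = 0) :
    Function.Injective fun x : ZMod 2 × ZMod 2 => fieldElt α x.1 x.2 := by
  have h2 : (2 : F) = 0 := CharTwo.two_eq_zero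
  have h0 : ∀ s t, fieldElt α s t = 0 → s = 0 ∧ t = 0 := by
    intro s t h
    have h01 : ∀ a : ZMod 2, a = 0 ∨ a = 1 := by decide
    rcases h01 s with rfl | rfl <;> rcases h01 t with rfl | rfl
    · exact ⟨rfl, rfl⟩
    · have : α = 0 := by simpa [fieldElt] using h
      simp [this] at hα
    · simp [fieldElt] at h
    · have h1 : α = 1 := by
        have : 1 + α = 0 := by simpa [fieldElt] using h
        linear_combination this - h2
      rw [h1] at hα
      have : (1 : F) = 0 := by linear_combination hα - h2
      exact absurd this one_ne_zero
  rintro ⟨s, t⟩ ⟨s', t'⟩ h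
  have h1 : fieldElt α (s + s') (t + t') = 0 := by
    rw [← fieldElt_add]
    have : fieldElt α s t = fieldElt α s' t' := h
    rw [this]
    exact CharTwo.add_self_eq_zero _
  obtain ⟨hs, ht⟩ := h0 _ _ h1
  rw [CharTwo.add_eq_zero] at hs ht
  rw [hs, ht]

theorem fieldElt_surjective (hF : Nat.card F = 4) (hα : α ^ 2 + α + 1 = 0) (x : F) :
    ∃ s t, fieldElt α s t = x := by
  have : Finite F := Nat.finite_of_card_ne_zero (by rw [hF]; norm_num)
  have hb : Function.Bijective fun x : ZMod 2 × ZMod 2 => fieldElt α x.1 x.2 :=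
    (Nat.bijective_iff_injective_and_card _).2
      ⟨fieldElt_injective hα, by rw [hF, Nat.card_eq_fintype_card]; rfl⟩
  obtain ⟨⟨s, t⟩, h⟩ := hb.2 x
  exact ⟨s, t, h⟩

/-- The point with coordinate vector `v`. -/
def pointOf (α : F) (v : V) : slantedGroup F :=
  slantedElt (fieldElt α (v 0) (v 1)) (fieldElt α (v 2) (v 3))
    (fieldElt α (v 4) (v 5) - fieldElt α (v 0) (v 1) * fieldElt α (v 2) (v 3))

/-- In characteristic two the term `y x' - x y'` of the group law is the coboundary of `x y`, so `z
+ x y` is additive on `S`. -/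
theorem pointOf_add (v w : V) : pointOf α (v + w) = pointOf α v * pointOf α w := by
  have h2 : (2 : F) = 0 := CharTwo.two_eq_zero
  simp only [pointOf, slantedElt_mul, slantedElt_inj, Pi.add_apply, ← fieldElt_add]
  refine ⟨trivial, trivial, ?_⟩
  linear_combination -(fieldElt α (v 2) (v 3) * fieldElt α (w 0) (w 1)) * h2

theorem pointOf_injective (hα : α ^ 2 + α + 1 = 0) : Function.Injective (pointOf α) := by
  intro v w h
  obtain ⟨h1, h2, h3⟩ := slantedElt_inj.1 h
  rw [h1, h2, sub_left_inj] at h3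
  have e1 := fieldElt_injective hα (a₁ := (_, _)) (a₂ := (_, _)) h1
  have e2 := fieldElt_injective hα (a₁ := (_, _)) (a₂ := (_, _)) h2
  have e3 := fieldElt_injective hα (a₁ := (_, _)) (a₂ := (_, _)) h3
  rw [Prod.mk.injEq] at e1 e2 e3
  funext r
  fin_cases r
  exacts [e1.1, e1.2, e2.1, e2.2, e3.1, e3.2]

theorem pointOf_surjective (hF : Nat.card F = 4) (hα : α ^ 2 + α + 1 = 0) :
    Function.Surjective (pointOf α) := by
  rintro ⟨_, x, y, z, rfl⟩
  obtain ⟨a, b, rfl⟩ := fieldElt_surjective hF hα x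
  obtain ⟨c, d, rfl⟩ := fieldElt_surjective hF hα y
  obtain ⟨e, f, h⟩ := fieldElt_surjective hF hα (z + fieldElt α a b * fieldElt α c d)
  refine ⟨![a, b, c, d, e, f], ?_⟩
  show slantedElt (fieldElt α a b) (fieldElt α c d)
    (fieldElt α e f - fieldElt α a b * fieldElt α c d) = slantedElt _ _ z
  rw [h, add_sub_cancel_right]

/-- The product of two elements of the field with four elements, in coordinates. -/
def coordMul (x y : ZMod 2 × ZMod 2) : ZMod 2 × ZMod 2 :=
  (x.1 * y.1 + x.2 * y.2, x.1 * y.2 + x.2 * y.1 + x.2 * y.2)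

/-- The coordinate vector of `M(μ a, μ b, 0)`. -/
def directionVec (a b μ : ZMod 2 × ZMod 2) : V :=
  let x := coordMul μ a
  let y := coordMul μ b
  let z := coordMul x y
  ![x.1, x.2, y.1, y.2, z.1, z.2]

theorem pointOf_directionVec (hα : α ^ 2 + α + 1 = 0) (a b μ : ZMod 2 × ZMod 2) :
    pointOf α (directionVec a b μ) =
      slantedElt (fieldElt α μ.1 μ.2 * fieldElt α a.1 a.2)
        (fieldElt α μ.1 μ.2 * fieldElt α b.1 b.2) 0 := by
  rw [fieldElt_mul hα, fieldElt_mul hα]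
  refine slantedElt_inj.2 ⟨rfl, rfl, ?_⟩
  rw [fieldElt_mul hα, sub_eq_zero]
  rfl

theorem exists_U_of_direction : ∀ a b : ZMod 2 × ZMod 2, (a, b) ≠ 0 →
    ∃ i, ∀ v : V, v ∈ U i ↔ ∃ μ, directionVec a b μ = v := by
  decide +kernel

theorem exists_direction_of_U : ∀ i : Fin 6, i ≠ 0 →
    ∃ a b : ZMod 2 × ZMod 2, (a, b) ≠ 0 ∧ ∀ v : V, v ∈ U i ↔ ∃ μ, directionVec a b μ = v := by
  decide +kernel

theorem mem_U_zero : ∀ v : V, v ∈ U 0 ↔ v 0 = 0 ∧ v 1 = 0 ∧ v 2 = 0 ∧ v 3 = 0 := by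
  decide +kernel

theorem pointOf_mem_central (hα : α ^ 2 + α + 1 = 0) (v : V) :
    pointOf α v ∈ centralSubgroup F ↔ v ∈ U 0 := by
  rw [mem_U_zero]
  constructor
  · rintro ⟨μ, h⟩
    obtain ⟨h1, h2, -⟩ := slantedElt_inj.1 h
    have e1 := fieldElt_injective hα (a₁ := (_, _)) (a₂ := (0, 0)) (h1.trans fieldElt_zero.symm)
    have e2 := fieldElt_injective hα (a₁ := (_, _)) (a₂ := (0, 0)) (h2.trans fieldElt_zero.symm)
    rw [Prod.mk.injEq] at e1 e2
    exact ⟨e1.1, e1.2, e2.1, e2.2⟩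
  · rintro ⟨h0, h1, h2, h3⟩
    refine ⟨fieldElt α (v 4) (v 5), slantedElt_inj.2 ?_⟩
    rw [h0, h1, h2, h3, fieldElt_zero, mul_zero, sub_zero]
    exact ⟨rfl, rfl, rfl⟩

theorem pointOf_mem_direction (hF : Nat.card F = 4) (hα : α ^ 2 + α + 1 = 0)
    (a b : ZMod 2 × ZMod 2) (v : V) :
    pointOf α v ∈ directionSubgroup (fieldElt α a.1 a.2) (fieldElt α b.1 b.2) ↔
      ∃ μ, directionVec a b μ = v := by
  constructor
  · rintro ⟨μ, h⟩
    obtain ⟨s, t, rfl⟩ := fieldElt_surjective hF hα μ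
    exact ⟨(s, t), pointOf_injective hα ((pointOf_directionVec hα a b (s, t)).trans h.symm)⟩
  · rintro ⟨μ, rfl⟩
    exact ⟨_, pointOf_directionVec hα a b μ⟩

theorem isLineSubgroup_iff (hF : Nat.card F = 4) (hα : α ^ 2 + α + 1 = 0)
    (X : Subgroup (slantedGroup F)) :
    IsLineSubgroup X ↔ ∃ i, ∀ v, pointOf α v ∈ X ↔ v ∈ U i := by
  constructor
  · rintro (rfl | ⟨a, b, hab, rfl⟩)
    · exact ⟨0, pointOf_mem_central hα⟩
    · obtain ⟨s, t, rfl⟩ := fieldElt_surjective hF hα a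
      obtain ⟨s', t', rfl⟩ := fieldElt_surjective hF hα b
      obtain ⟨i, hi⟩ := exists_U_of_direction (s, t) (s', t') (by
        rintro h
        rw [Prod.mk_eq_zero, Prod.mk_eq_zero, Prod.mk_eq_zero] at h
        obtain ⟨⟨rfl, rfl⟩, rfl, rfl⟩ := h
        exact hab (by rw [fieldElt_zero]))
      exact ⟨i, fun v => (pointOf_mem_direction hF hα (s, t) (s', t') v).trans (hi v).symm⟩
  · rintro ⟨i, hi⟩
    have hX : ∀ Y : Subgroup (slantedGroup F), (∀ v, pointOf α v ∈ Y ↔ v ∈ U i) → X = Y := by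
      intro Y hY
      ext g
      obtain ⟨v, rfl⟩ := pointOf_surjective hF hα g
      rw [hi, hY]
    by_cases h0 : i = 0
    · subst h0
      exact Or.inl (hX _ (pointOf_mem_central hα))
    · obtain ⟨a, b, hab, h⟩ := exists_direction_of_U i h0
      refine Or.inr ⟨_, _, fun h' => hab ?_,
        hX _ fun v => (pointOf_mem_direction hF hα a b v).trans (h v).symm⟩
      rw [Prod.mk.injEq] at h'
      have e1 := fieldElt_injective hα (a₂ := (0, 0)) (h'.1.trans fieldElt_zero.symm)
      have e2 := fieldElt_injective hα (a₂ := (0, 0)) (h'.2.trans fieldElt_zero.symm)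
      rw [e1, e2]
      rfl

end Coordinates

/-- The identification of the points of the quadrangle with `V`; it maps the line subgroups to
`U₁, …, U₆`. -/
theorem exists_coordinateIso {F : Type*} [Field F] (hF : Nat.card F = 4) {α : F}
    (hα : α ^ 2 + α + 1 = 0) :
    ∃ Φ : slantedGroup F ≃* Multiplicative V, IsCoordinateIso α Φ ∧
      ∀ X : Subgroup (slantedGroup F), IsLineSubgroup X ↔
        ∃ i, ∀ g, g ∈ X ↔ (Φ g).toAdd ∈ U i := by
  have := charTwo_of_card_eq_four hF
  let Ψ : Multiplicative V ≃* slantedGroup F := MulEquiv.ofBijective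
    (MonoidHom.mk' (fun v : Multiplicative V => pointOf α v.toAdd)
      fun v w => pointOf_add v.toAdd w.toAdd)
    ⟨pointOf_injective hα, pointOf_surjective hF hα⟩
  have hΨ : ∀ v : V, Ψ (.ofAdd v) = pointOf α v := fun _ => rfl
  refine ⟨Ψ.symm, ?_, fun X => ?_⟩
  · simp only [IsCoordinateIso, MulEquiv.symm_apply_eq, hΨ, pointOf, slantedElt_inj]
    simp [fieldElt]
  · rw [isLineSubgroup_iff hF hα]
    refine exists_congr fun i => ⟨fun h g => ?_, fun h v => ?_⟩
    · rw [← h, ← hΨ, ofAdd_toAdd, MulEquiv.apply_symm_apply]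
    · rw [← hΨ, h, MulEquiv.symm_apply_apply, toAdd_ofAdd]

/-! ### Automorphisms as permutations of `V` -/

section Automorphisms

variable {F : Type*} [Field F]

/-- `Φ` maps the line subgroups to `U₁, …, U₆`. -/
def MatchesLines (Φ : slantedGroup F ≃* Multiplicative V) : Prop :=
  ∀ X : Subgroup (slantedGroup F), IsLineSubgroup X ↔ ∃ i, ∀ g, g ∈ X ↔ (Φ g).toAdd ∈ U i

/-- The points as vectors. -/
def vecEquiv (Φ : slantedGroup F ≃* Multiplicative V) : slantedGroup F ≃ V :=
  Φ.toEquiv.trans Multiplicative.toAdd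

variable {Φ : slantedGroup F ≃* Multiplicative V}

theorem vecEquiv_inv_mul (g p : slantedGroup F) :
    vecEquiv Φ (g⁻¹ * p) = vecEquiv Φ p - vecEquiv Φ g := by
  show (Φ (g⁻¹ * p)).toAdd = (Φ p).toAdd - (Φ g).toAdd
  rw [map_mul, map_inv, toAdd_mul, toAdd_inv]
  abel

theorem isLine_iff (hΦ : MatchesLines Φ) (L : Set (slantedGroup F)) :
    (∃ X : Subgroup (slantedGroup F), IsLineSubgroup X ∧
      ∃ g : slantedGroup F, L = (fun h => g * h) '' (X : Set (slantedGroup F))) ↔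
    ∃ i v, ∀ p, p ∈ L ↔ vecEquiv Φ p - v ∈ U i := by
  constructor
  · rintro ⟨X, hX, g, rfl⟩
    obtain ⟨i, hi⟩ := (hΦ X).1 hX
    refine ⟨i, vecEquiv Φ g, fun p => ?_⟩
    rw [← vecEquiv_inv_mul]
    refine Iff.trans ?_ (hi (g⁻¹ * p))
    constructor
    · rintro ⟨h, hh, rfl⟩
      rwa [inv_mul_cancel_left]
    · exact fun h => ⟨g⁻¹ * p, h, mul_inv_cancel_left g p⟩
  · rintro ⟨i, v, h⟩
    obtain ⟨g, rfl⟩ := (vecEquiv Φ).surjective v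
    refine ⟨(AddSubgroup.toSubgroup (U i).toAddSubgroup).comap Φ.toMonoidHom,
      (hΦ _).2 ⟨i, fun g => Iff.rfl⟩, g, ?_⟩
    ext p
    rw [h, ← vecEquiv_inv_mul]
    constructor
    · exact fun h => ⟨g⁻¹ * p, h, mul_inv_cancel_left g p⟩
    · rintro ⟨h, hh, rfl⟩
      rwa [inv_mul_cancel_left]

/-- The line through `v` in direction `U i`. -/
def lineThrough (hΦ : MatchesLines Φ) (i : Fin 6) (v : V) : SlantedLine F :=
  ⟨{p | vecEquiv Φ p - v ∈ U i}, (isLine_iff hΦ _).2 ⟨i, v, fun _ => Iff.rfl⟩⟩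

theorem mem_lineThrough (hΦ : MatchesLines Φ) {i : Fin 6} {v : V} {p : slantedGroup F} :
    p ∈ (lineThrough hΦ i v).1 ↔ vecEquiv Φ p - v ∈ U i := Iff.rfl

theorem exists_eq_lineThrough (hΦ : MatchesLines Φ) (L : SlantedLine F) : ∃ i v, L = lineThrough hΦ i v := by
  obtain ⟨i, v, h⟩ := (isLine_iff hΦ L.1).1 L.2
  exact ⟨i, v, Subtype.ext (Set.ext h)⟩

theorem lineThrough_eq_of_mem (hΦ : MatchesLines Φ) {i : Fin 6} {v w : V} (h : v - w ∈ U i) :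
    lineThrough hΦ i v = lineThrough hΦ i w := by
  refine Subtype.ext (Set.ext fun p => ?_)
  rw [mem_lineThrough, mem_lineThrough, ← Submodule.add_mem_iff_left (U i) h]
  rw [sub_add_sub_cancel]

theorem lineThrough_inj (hΦ : MatchesLines Φ) {i j : Fin 6} {v : V} :
    lineThrough hΦ i v = lineThrough hΦ j v ↔ i = j := by
  refine ⟨fun h => eq_of_planeVec_mem i j ?_, fun h => h ▸ rfl⟩
  have h1 : (vecEquiv Φ).symm (v + planeVec i 1 0) ∈ (lineThrough hΦ i v).1 := by
    rw [mem_lineThrough, Equiv.apply_symm_apply, add_sub_cancel_left]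
    exact planeVec_mem i 1 0
  rw [h, mem_lineThrough, Equiv.apply_symm_apply, add_sub_cancel_left] at h1
  exact h1

theorem adj_lineThrough (hΦ : MatchesLines Φ) {i : Fin 6} {v : V} {p : slantedGroup F} :
    (slantedQuadrangle F).Adj (Sum.inl p) (Sum.inr (lineThrough hΦ i v)) ↔
      vecEquiv Φ p - v ∈ U i := Iff.rfl

/-- If a point went to a line, the six lines through it would go injectively to the four points of
that line. -/
theorem exists_map_inl (hΦ : MatchesLines Φ) (g : slantedQuadrangle F ≃g slantedQuadrangle F) (p : slantedGroup F) :
    ∃ q, g (Sum.inl p) = Sum.inl q := by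
  rcases hg : g (Sum.inl p) with q | L
  · exact ⟨q, rfl⟩
  exfalso
  obtain ⟨j, v, rfl⟩ := exists_eq_lineThrough hΦ L
  have h : ∀ i : Fin 6, ∃ x : ZMod 2 × ZMod 2,
      g (Sum.inr (lineThrough hΦ i (vecEquiv Φ p))) =
        Sum.inl ((vecEquiv Φ).symm (v + planeVec j x.1 x.2)) := by
    intro i
    have h1 : (slantedQuadrangle F).Adj (Sum.inl p)
        (Sum.inr (lineThrough hΦ i (vecEquiv Φ p))) := by
      rw [adj_lineThrough, sub_self]
      exact zero_mem _
    rw [← g.map_adj_iff, hg] at h1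
    rcases hq : g (Sum.inr (lineThrough hΦ i (vecEquiv Φ p))) with q | K
    · rw [hq] at h1
      obtain ⟨s, t, hst⟩ := mem_U_iff.1 ((adj_lineThrough hΦ).1 h1.symm)
      refine ⟨(s, t), ?_⟩
      rw [hst, add_sub_cancel, Equiv.symm_apply_apply]
    · rw [hq] at h1
      exact h1.elim
  choose x hx using h
  have hinj : Function.Injective x := by
    intro i i' hi
    have h1 := (hx i).trans ((hi ▸ rfl : _ = _).trans (hx i').symm)
    exact (lineThrough_inj hΦ).1 (Sum.inr_injective (g.injective h1))
  have hcard := Fintype.card_le_of_injective x hinj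
  revert hcard
  decide

/-- The coordinate vector of a point; lines are mapped to `0`. -/
def vertexVec (Φ : slantedGroup F ≃* Multiplicative V) : slantedGroup F ⊕ SlantedLine F → V :=
  Sum.elim (vecEquiv Φ) fun _ => 0

/-- The default value `0` on lines is never met, because the image of a point is a point. -/
theorem inl_vertexVec (hΦ : MatchesLines Φ) (g : slantedQuadrangle F ≃g slantedQuadrangle F) (p : slantedGroup F) :
    Sum.inl ((vecEquiv Φ).symm (vertexVec Φ (g (Sum.inl p)))) = g (Sum.inl p) := by
  obtain ⟨q, hq⟩ := exists_map_inl hΦ g p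
  rw [hq]
  exact congrArg Sum.inl ((vecEquiv Φ).symm_apply_apply q)

/-- The action of the automorphism group on the points, as permutations of `V`. -/
def autHom (hΦ : MatchesLines Φ) : (slantedQuadrangle F ≃g slantedQuadrangle F) →* Equiv.Perm V :=
  MonoidHom.mk'
    (fun g =>
      { toFun := fun v => vertexVec Φ (g (Sum.inl ((vecEquiv Φ).symm v)))
        invFun := fun v => vertexVec Φ (g.symm (Sum.inl ((vecEquiv Φ).symm v)))
        left_inv := fun v => by
          beta_reduce
          rw [inl_vertexVec hΦ, RelIso.symm_apply_apply]
          exact (vecEquiv Φ).apply_symm_apply v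
        right_inv := fun v => by
          beta_reduce
          rw [inl_vertexVec hΦ, RelIso.apply_symm_apply]
          exact (vecEquiv Φ).apply_symm_apply v })
    fun g h => by
      ext1 v
      show vertexVec Φ (g (h (Sum.inl ((vecEquiv Φ).symm v)))) =
        vertexVec Φ (g (Sum.inl ((vecEquiv Φ).symm
          (vertexVec Φ (h (Sum.inl ((vecEquiv Φ).symm v)))))))
      rw [inl_vertexVec hΦ]

theorem map_inl (hΦ : MatchesLines Φ) (g : slantedQuadrangle F ≃g slantedQuadrangle F) (p : slantedGroup F) :
    g (Sum.inl p) = Sum.inl ((vecEquiv Φ).symm (autHom hΦ g (vecEquiv Φ p))) := by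
  show g (Sum.inl p) = Sum.inl ((vecEquiv Φ).symm
    (vertexVec Φ (g (Sum.inl ((vecEquiv Φ).symm (vecEquiv Φ p))))))
  rw [inl_vertexVec hΦ, Equiv.symm_apply_apply]

theorem exists_map_inr (hΦ : MatchesLines Φ) (g : slantedQuadrangle F ≃g slantedQuadrangle F) (L : SlantedLine F) :
    ∃ K, g (Sum.inr L) = Sum.inr K := by
  rcases hg : g (Sum.inr L) with q | K
  · exfalso
    have h1 : g.symm (Sum.inl q) = Sum.inr L := by rw [← hg, RelIso.symm_apply_apply]
    obtain ⟨p, hp⟩ := exists_map_inl hΦ g.symm q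
    rw [hp] at h1
    cases h1
  · exact ⟨K, rfl⟩

theorem map_inr_lineThrough (hΦ : MatchesLines Φ) (g : slantedQuadrangle F ≃g slantedQuadrangle F) (i : Fin 6) (v : V) :
    ∃ j, g (Sum.inr (lineThrough hΦ i v)) = Sum.inr (lineThrough hΦ j (autHom hΦ g v)) ∧
      ∀ w, w - v ∈ U i ↔ autHom hΦ g w - autHom hΦ g v ∈ U j := by
  obtain ⟨K, hK⟩ := exists_map_inr hΦ g (lineThrough hΦ i v)
  obtain ⟨j, u, rfl⟩ := exists_eq_lineThrough hΦ K
  have hadj : ∀ w, w - v ∈ U i ↔ autHom hΦ g w - u ∈ U j := by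
    intro w
    have h := g.map_adj_iff (v := Sum.inl ((vecEquiv Φ).symm w))
      (w := Sum.inr (lineThrough hΦ i v))
    rw [hK, map_inl hΦ, adj_lineThrough, adj_lineThrough, Equiv.apply_symm_apply,
      Equiv.apply_symm_apply] at h
    exact h.symm
  have hv : autHom hΦ g v - u ∈ U j := (hadj v).1 (by rw [sub_self]; exact zero_mem _)
  rw [← lineThrough_eq_of_mem hΦ hv] at hK
  refine ⟨j, hK, fun w => ?_⟩
  rw [hadj, ← Submodule.sub_mem_iff_left (U j) hv, sub_sub_sub_cancel_right]

theorem preservesCosets_autHom (hΦ : MatchesLines Φ) (g : slantedQuadrangle F ≃g slantedQuadrangle F) :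
    PreservesCosets (autHom hΦ g) := fun i v =>
  (map_inr_lineThrough hΦ g i v).imp fun _ h => h.2

theorem eq_of_mem_iff {f : Equiv.Perm V} {j j' : Fin 6} {v : V}
    (h : ∀ w, f w - f v ∈ U j ↔ f w - f v ∈ U j') : j = j' := by
  apply eq_of_planeVec_mem
  have := (h (f.symm (f v + planeVec j 1 0))).1 (by
    rw [Equiv.apply_symm_apply, add_sub_cancel_left]
    exact planeVec_mem j 1 0)
  rwa [Equiv.apply_symm_apply, add_sub_cancel_left] at this

theorem map_inr_of_iff (hΦ : MatchesLines Φ) {g : slantedQuadrangle F ≃g slantedQuadrangle F} {i j : Fin 6} {v : V}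
    (h : ∀ w, w - v ∈ U i ↔ autHom hΦ g w - autHom hΦ g v ∈ U j) :
    g (Sum.inr (lineThrough hΦ i v)) = Sum.inr (lineThrough hΦ j (autHom hΦ g v)) := by
  obtain ⟨j', hg, hj'⟩ := map_inr_lineThrough hΦ g i v
  rw [hg, eq_of_mem_iff fun w => (hj' w).symm.trans (h w)]

theorem autHom_injective (hΦ : MatchesLines Φ) : Function.Injective (autHom hΦ) := by
  rw [injective_iff_map_eq_one]
  intro g hg
  apply RelIso.ext
  rintro (p | L)
  · rw [map_inl hΦ, hg, Equiv.Perm.one_apply, Equiv.symm_apply_apply]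
    rfl
  · obtain ⟨i, v, rfl⟩ := exists_eq_lineThrough hΦ L
    rw [map_inr_of_iff hΦ (j := i) (by rw [hg]; exact fun _ => Iff.rfl), hg]
    rfl

/-- The automorphism induced by a permutation of `V` that permutes the cosets of the `U i`. -/
def isoOfPerm (hΦ : MatchesLines Φ) (f : Equiv.Perm V) (π : Equiv.Perm (Fin 6))
    (hf : ∀ i v w, w - v ∈ U i ↔ f w - f v ∈ U (π i)) :
    slantedQuadrangle F ≃g slantedQuadrangle F where
  toEquiv :=
    let e : Equiv.Perm (slantedGroup F) := ((vecEquiv Φ).trans f).trans (vecEquiv Φ).symm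
    Equiv.sumCongr e ((Equiv.Set.congr e).subtypeEquiv fun L => by
      have he : ∀ p, vecEquiv Φ (e p) = f (vecEquiv Φ p) :=
        fun p => (vecEquiv Φ).apply_symm_apply _
      have hmem : ∀ p, e p ∈ Equiv.Set.congr e L ↔ p ∈ L :=
        fun p => e.injective.mem_set_image
      rw [isLine_iff hΦ, isLine_iff hΦ]
      constructor
      · rintro ⟨i, v, h⟩
        refine ⟨π i, f v, fun p => ?_⟩
        obtain ⟨p, rfl⟩ := e.surjective p
        rw [hmem, h, he, hf]
      · rintro ⟨j, w, h⟩
        refine ⟨π.symm j, f.symm w, fun p => ?_⟩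
        rw [← hmem, h, he, hf (π.symm j), Equiv.apply_symm_apply, Equiv.apply_symm_apply])
  map_rel_iff' := by
    rintro (p | L) (q | K)
    · exact Iff.rfl
    · exact (Equiv.injective _).mem_set_image
    · exact (Equiv.injective _).mem_set_image
    · exact Iff.rfl

theorem autHom_isoOfPerm (hΦ : MatchesLines Φ) (f : Equiv.Perm V) (π : Equiv.Perm (Fin 6))
    (hf : ∀ i v w, w - v ∈ U i ↔ f w - f v ∈ U (π i)) :
    autHom hΦ (isoOfPerm hΦ f π hf) = f := by
  ext1 v
  show vecEquiv Φ ((vecEquiv Φ).symm (f (vecEquiv Φ ((vecEquiv Φ).symm v)))) = f v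
  rw [Equiv.apply_symm_apply, Equiv.apply_symm_apply]

end Automorphisms

/-! ### The affine group -/

theorem affineApply_mul (f g : AGL) (v : V) :
    affineApply (f * g) v = affineApply f (affineApply g v) := by
  show (f * g).right.val *ᵥ v + (f * g).left.toAdd = _
  rw [SemidirectProduct.mul_left, SemidirectProduct.mul_right, Units.val_mul,
    ← Matrix.mulVec_mulVec, toAdd_mul]
  show _ = f.right.val *ᵥ (g.right.val *ᵥ v + g.left.toAdd) + f.left.toAdd
  rw [Matrix.mulVec_add, add_assoc, add_comm f.left.toAdd]
  rfl

theorem affineApply_one (v : V) : affineApply 1 v = v := by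
  show (1 : AGL).right.val *ᵥ v + (1 : AGL).left.toAdd = v
  simp

/-- The action of the affine group on `V`. -/
def affineHom : AGL →* Equiv.Perm V :=
  MonoidHom.mk'
    (fun f =>
      { toFun := affineApply f
        invFun := affineApply f⁻¹
        left_inv := fun v => by rw [← affineApply_mul, inv_mul_cancel, affineApply_one]
        right_inv := fun v => by rw [← affineApply_mul, mul_inv_cancel, affineApply_one] })
    fun f g => Equiv.ext (affineApply_mul f g)

theorem affineHom_apply (f : AGL) (v : V) :
    affineHom f v = f.right.val *ᵥ v + f.left.toAdd := rfl

theorem affineHom_injective : Function.Injective affineHom := by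
  intro f g h
  have hleft : f.left.toAdd = g.left.toAdd := by
    have := Equiv.congr_fun h 0
    rwa [affineHom_apply, affineHom_apply, Matrix.mulVec_zero, Matrix.mulVec_zero, zero_add,
      zero_add] at this
  refine SemidirectProduct.ext hleft (Units.ext (Matrix.ext_of_mulVec_single fun j => ?_))
  have := Equiv.congr_fun h (Pi.single j 1)
  rwa [affineHom_apply, affineHom_apply, hleft, add_left_inj] at this

/-- The linear part of an element of `V ⋊ ⟨A, C⟩`. -/
def linearPart : affineGroup groupAC →* groupAC :=
  (SemidirectProduct.rightHom.comp (affineGroup groupAC).subtype).codRestrict groupAC fun f => f.2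

theorem affineHom_sub_mem (f : affineGroup groupAC) (i : Fin 6) (v w : V) :
    w - v ∈ U i ↔ affineHom f.1 w - affineHom f.1 v ∈ U (typeHom (linearPart f) i) := by
  rw [affineHom_apply, affineHom_apply, add_sub_add_right_eq_sub, ← Matrix.mulVec_sub]
  exact inducesPerm_typeHom (linearPart f) i (w - v)

/-- Both groups embed into the permutations of `V`, so comparing their images there suffices to
identify them. -/
theorem range_autHom {F : Type*} [Field F] {Φ : slantedGroup F ≃* Multiplicative V}
    (hΦ : MatchesLines Φ) :
    (affineHom.comp (affineGroup groupAC).subtype).range = (autHom hΦ).range := by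
  ext f
  constructor
  · rintro ⟨f, rfl⟩
    exact ⟨_, autHom_isoOfPerm hΦ _ _ (affineHom_sub_mem f)⟩
  · rintro ⟨g, rfl⟩
    obtain ⟨h, hh⟩ := (preservesCosets_autHom hΦ g).exists_affine
    exact ⟨⟨⟨.ofAdd (autHom hΦ g 0), h.1⟩, h.2⟩, Equiv.ext fun v => (hh v).symm⟩

/-- The affine group `V ⋊ ⟨A, C⟩` is the automorphism group of the quadrangle. -/
noncomputable def affineEquivAut {F : Type*} [Field F] {Φ : slantedGroup F ≃* Multiplicative V}
    (hΦ : MatchesLines Φ) :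
    affineGroup groupAC ≃* (slantedQuadrangle F ≃g slantedQuadrangle F) :=
  ((MonoidHom.ofInjective (f := affineHom.comp (affineGroup groupAC).subtype)
      (affineHom_injective.comp Subtype.val_injective)).trans
    (MulEquiv.subgroupCongr (range_autHom hΦ))).trans
    (MonoidHom.ofInjective (autHom_injective hΦ)).symm

theorem autHom_affineEquivAut {F : Type*} [Field F] {Φ : slantedGroup F ≃* Multiplicative V}
    (hΦ : MatchesLines Φ) (f : affineGroup groupAC) :
    autHom hΦ (affineEquivAut hΦ f) = affineHom f.1 :=
  MonoidHom.apply_ofInjective_symm (autHom_injective hΦ) _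

/-! ### Chamber-regular subgroups -/

section Chambers

variable {F : Type*} [Field F] {Φ : slantedGroup F ≃* Multiplicative V}

theorem affineEquivAut_inl (hΦ : MatchesLines Φ) (f : affineGroup groupAC) (p : slantedGroup F) :
    affineEquivAut hΦ f (Sum.inl p) =
      Sum.inl ((vecEquiv Φ).symm (affineApply f.1 (vecEquiv Φ p))) := by
  rw [map_inl hΦ, autHom_affineEquivAut]
  rfl

theorem affineEquivAut_inr (hΦ : MatchesLines Φ) (f : affineGroup groupAC) (i : Fin 6) (v : V) :
    affineEquivAut hΦ f (Sum.inr (lineThrough hΦ i v)) =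
      Sum.inr (lineThrough hΦ (typeHom (linearPart f) i) (affineApply f.1 v)) := by
  rw [map_inr_of_iff hΦ (j := typeHom (linearPart f) i)
    (by rw [autHom_affineEquivAut]; exact affineHom_sub_mem f i v), autHom_affineEquivAut]
  rfl

/-- The affine map `v ↦ k v + t`. -/
def affineMk (t : V) (k : groupAC) : affineGroup groupAC := ⟨⟨.ofAdd t, k.1⟩, k.2⟩

theorem linearPart_affineMk (t : V) (k : groupAC) : linearPart (affineMk t k) = k := rfl

theorem affineApply_affineMk (t : V) (k : groupAC) (v : V) :
    affineApply (affineMk t k).1 v = k.1.val *ᵥ v + t := rfl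

theorem affineMk_linearPart (f : affineGroup groupAC) :
    affineMk f.1.left.toAdd (linearPart f) = f := rfl

/-- The chamber formed by the point `v` and the line through `v` in direction `U i`. -/
def chamber (hΦ : MatchesLines Φ) (v : V) (i : Fin 6) :
    Sym2 (slantedGroup F ⊕ SlantedLine F) :=
  s(Sum.inl ((vecEquiv Φ).symm v), Sum.inr (lineThrough hΦ i v))

theorem mem_edgeSet_iff (hΦ : MatchesLines Φ) (c : Sym2 (slantedGroup F ⊕ SlantedLine F)) :
    c ∈ (slantedQuadrangle F).edgeSet ↔ ∃ v i, c = chamber hΦ v i := by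
  have key : ∀ p L, (slantedQuadrangle F).Adj (Sum.inl p) (Sum.inr L) →
      ∃ v i, s(Sum.inl p, Sum.inr L) = chamber hΦ v i := by
    intro p L h
    obtain ⟨i, v, rfl⟩ := exists_eq_lineThrough hΦ L
    refine ⟨vecEquiv Φ p, i, ?_⟩
    rw [chamber, Equiv.symm_apply_apply, lineThrough_eq_of_mem hΦ ((adj_lineThrough hΦ).1 h)]
  constructor
  · induction c with
    | h x y =>
      intro h
      rw [SimpleGraph.mem_edgeSet] at h
      rcases x with p | L <;> rcases y with q | K
      · exact h.elim
      · exact key p K h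
      · rw [Sym2.eq_swap]
        exact key q L h.symm
      · exact h.elim
  · rintro ⟨v, i, rfl⟩
    rw [chamber, SimpleGraph.mem_edgeSet, adj_lineThrough, Equiv.apply_symm_apply, sub_self]
    exact zero_mem _

theorem chamber_inj (hΦ : MatchesLines Φ) {v w : V} {i j : Fin 6} :
    chamber hΦ v i = chamber hΦ w j ↔ v = w ∧ i = j := by
  refine ⟨fun h => ?_, by rintro ⟨rfl, rfl⟩; rfl⟩
  rw [chamber, chamber, Sym2.eq_iff] at h
  rcases h with ⟨h1, h2⟩ | ⟨h1, -⟩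
  · have hv := (vecEquiv Φ).symm.injective (Sum.inl_injective h1)
    subst hv
    exact ⟨rfl, (lineThrough_inj hΦ).1 (Sum.inr_injective h2)⟩
  · cases h1

theorem map_chamber (hΦ : MatchesLines Φ) (f : affineGroup groupAC) (v : V) (i : Fin 6) :
    Sym2.map (affineEquivAut hΦ f) (chamber hΦ v i) =
      chamber hΦ (affineApply f.1 v) (typeHom (linearPart f) i) := by
  rw [chamber, Sym2.map_mk, affineEquivAut_inl, affineEquivAut_inr, Equiv.apply_symm_apply]
  rfl

/-- `H` corresponds to `V ⋊ K` under the identification of the automorphism group with the affine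
group. -/
def HasLinearPart (hΦ : MatchesLines Φ) (H : Subgroup (slantedQuadrangle F ≃g slantedQuadrangle F))
    (K : Subgroup groupAC) : Prop :=
  ∀ f, affineEquivAut hΦ f ∈ H ↔ linearPart f ∈ K

theorem hasLinearPart_affineImage (hΦ : MatchesLines Φ) (K : Subgroup (GL (Fin 6) (ZMod 2))) :
    HasLinearPart hΦ (affineImage (affineEquivAut hΦ) K) (K.subgroupOf groupAC) := by
  intro f
  constructor
  · rintro ⟨f', hf', h⟩
    rw [← (affineEquivAut hΦ).injective h]
    exact hf'
  · exact fun h => ⟨f, h, rfl⟩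

/-- A chamber is a pair `(v, i)`, on which `v ↦ k v + t` acts by `(v, i) ↦ (k v + t, k i)`. Once `k`
is known, the points determine `t`, so only the action of `K` on directions matters. -/
theorem HasLinearPart.isChamberRegular_iff {hΦ : MatchesLines Φ}
    {H : Subgroup (slantedQuadrangle F ≃g slantedQuadrangle F)} {K : Subgroup groupAC}
    (hH : HasLinearPart hΦ H K) : IsChamberRegular H ↔ IsTypeRegular K := by
  constructor
  · intro h i j
    obtain ⟨g, ⟨hg, hgc⟩, huniq⟩ := h (chamber hΦ 0 i) ((mem_edgeSet_iff hΦ _).2 ⟨_, _, rfl⟩)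
      (chamber hΦ 0 j) ((mem_edgeSet_iff hΦ _).2 ⟨_, _, rfl⟩)
    obtain ⟨f, rfl⟩ := (affineEquivAut hΦ).surjective g
    rw [map_chamber, chamber_inj] at hgc
    refine ⟨linearPart f, ⟨(hH f).1 hg, hgc.2⟩, ?_⟩
    rintro k ⟨hk, hkj⟩
    have := huniq (affineEquivAut hΦ (affineMk 0 k)) ⟨(hH _).2 hk, by
      rw [map_chamber, chamber_inj, affineApply_affineMk, Matrix.mulVec_zero, add_zero]
      exact ⟨rfl, hkj⟩⟩
    rw [← (affineEquivAut hΦ).injective this, linearPart_affineMk]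
  · intro h c hc d hd
    obtain ⟨v, i, rfl⟩ := (mem_edgeSet_iff hΦ c).1 hc
    obtain ⟨w, j, rfl⟩ := (mem_edgeSet_iff hΦ d).1 hd
    obtain ⟨k, ⟨hk, hkj⟩, huniq⟩ := h i j
    refine ⟨affineEquivAut hΦ (affineMk (w - k.1.val *ᵥ v) k), ⟨(hH _).2 hk, ?_⟩, ?_⟩
    · rw [map_chamber, chamber_inj, affineApply_affineMk, add_sub_cancel]
      exact ⟨rfl, hkj⟩
    · rintro g ⟨hg, hgc⟩
      obtain ⟨f, rfl⟩ := (affineEquivAut hΦ).surjective g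
      rw [map_chamber, chamber_inj] at hgc
      have hf := huniq (linearPart f) ⟨(hH f).1 hg, hgc.2⟩
      have hl : f.1.left.toAdd = w - k.1.val *ᵥ v := by
        rw [← hgc.1, ← hf]
        exact (add_sub_cancel_left _ _).symm
      rw [← affineMk_linearPart f, hf, hl]

theorem HasLinearPart.affineImage_bot_le {hΦ : MatchesLines Φ}
    {H : Subgroup (slantedQuadrangle F ≃g slantedQuadrangle F)} {K : Subgroup groupAC}
    (hH : HasLinearPart hΦ H K) : affineImage (affineEquivAut hΦ) ⊥ ≤ H := by
  intro g hg
  obtain ⟨f, rfl⟩ := (affineEquivAut hΦ).surjective g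
  have h1 : linearPart f = 1 := Subtype.ext ((hasLinearPart_affineImage hΦ ⊥ f).1 hg)
  rw [hH, h1]
  exact one_mem K

/-- A subgroup containing the translations is a union of their cosets, hence the full preimage of
its group of linear parts. -/
theorem exists_hasLinearPart {hΦ : MatchesLines Φ}
    {H : Subgroup (slantedQuadrangle F ≃g slantedQuadrangle F)}
    (hH : affineImage (affineEquivAut hΦ) ⊥ ≤ H) : ∃ K, HasLinearPart hΦ H K := by
  refine ⟨(H.comap (affineEquivAut hΦ).toMonoidHom).map linearPart, fun f => ⟨fun h => ⟨f, h, rfl⟩, ?_⟩⟩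
  rintro ⟨f', hf', h⟩
  have h1 : affineEquivAut hΦ (f'⁻¹ * f) ∈ H := by
    refine hH ((hasLinearPart_affineImage hΦ ⊥ _).2 ?_)
    rw [map_mul, map_inv, h, inv_mul_cancel]
    exact one_mem _
  have h2 : affineEquivAut hΦ f' ∈ H := hf'
  have h3 := mul_mem h2 h1
  rwa [← map_mul, mul_inv_cancel_left] at h3

theorem mem_map_conj_iff {G : Type*} [Group G] {K : Subgroup G} {g x : G} :
    x ∈ K.map (MulAut.conj g).toMonoidHom ↔ g⁻¹ * x * g ∈ K := by
  constructor
  · rintro ⟨k, hk, rfl⟩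
    simpa [mul_assoc] using hk
  · exact fun h => ⟨_, h, by simp [mul_assoc]⟩

theorem AreConjugate.symm {G : Type*} [Group G] {H K : Subgroup G} (h : AreConjugate H K) :
    AreConjugate K H := by
  obtain ⟨g, rfl⟩ := h
  refine ⟨g⁻¹, ?_⟩
  ext x
  rw [mem_map_conj_iff, mem_map_conj_iff]
  simp [mul_assoc]

theorem HasLinearPart.map_conj {hΦ : MatchesLines Φ}
    {H : Subgroup (slantedQuadrangle F ≃g slantedQuadrangle F)} {K : Subgroup groupAC}
    (hH : HasLinearPart hΦ H K) (m : affineGroup groupAC) :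
    HasLinearPart hΦ (H.map (MulAut.conj (affineEquivAut hΦ m)).toMonoidHom)
      (K.map (MulAut.conj (linearPart m)).toMonoidHom) := by
  intro f
  rw [mem_map_conj_iff, mem_map_conj_iff, ← map_inv, ← map_inv, ← map_mul, ← map_mul, ← map_mul,
    ← map_mul]
  exact hH _

theorem HasLinearPart.unique_right {hΦ : MatchesLines Φ}
    {H : Subgroup (slantedQuadrangle F ≃g slantedQuadrangle F)} {K L : Subgroup groupAC}
    (hK : HasLinearPart hΦ H K) (hL : HasLinearPart hΦ H L) : K = L := by
  ext k
  rw [← linearPart_affineMk 0 k, ← hK, ← hL]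

theorem HasLinearPart.unique_left {hΦ : MatchesLines Φ}
    {H I : Subgroup (slantedQuadrangle F ≃g slantedQuadrangle F)} {K : Subgroup groupAC}
    (hH : HasLinearPart hΦ H K) (hI : HasLinearPart hΦ I K) : H = I := by
  ext g
  obtain ⟨f, rfl⟩ := (affineEquivAut hΦ).surjective g
  rw [hH, hI]

theorem HasLinearPart.areConjugate_iff {hΦ : MatchesLines Φ}
    {H I : Subgroup (slantedQuadrangle F ≃g slantedQuadrangle F)} {K L : Subgroup groupAC}
    (hH : HasLinearPart hΦ H K) (hI : HasLinearPart hΦ I L) :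
    AreConjugate H I ↔ AreConjugate K L := by
  constructor
  · rintro ⟨g, rfl⟩
    obtain ⟨m, rfl⟩ := (affineEquivAut hΦ).surjective g
    exact ⟨linearPart m, hI.unique_right (hH.map_conj m)⟩
  · rintro ⟨g, rfl⟩
    exact ⟨affineEquivAut hΦ (affineMk 0 g), hI.unique_left (hH.map_conj (affineMk 0 g))⟩

theorem HasLinearPart.isChamberRegular_of_areConjugate {hΦ : MatchesLines Φ}
    {H I : Subgroup (slantedQuadrangle F ≃g slantedQuadrangle F)} {K : Subgroup groupAC}
    (hI : HasLinearPart hΦ I K) (hK : IsTypeRegular K) (h : AreConjugate H I) :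
    IsChamberRegular H ∧ affineImage (affineEquivAut hΦ) ⊥ ≤ H := by
  obtain ⟨g, rfl⟩ := h.symm
  obtain ⟨m, rfl⟩ := (affineEquivAut hΦ).surjective g
  have hH := hI.map_conj m
  exact ⟨hH.isChamberRegular_iff.2 (hK.map_conj _), hH.affineImage_bot_le⟩

/-- The group `⟨A⟩` is abelian, while `B` and `C` do not commute. -/
theorem not_areConjugate_groupA_groupBC :
    ¬ AreConjugate (groupA.subgroupOf groupAC) (groupBC.subgroupOf groupAC) := by
  rintro ⟨g, hg⟩
  have hB : eltB ∈ groupBC.subgroupOf groupAC := by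
    rw [Subgroup.mem_subgroupOf, coe_eltB]
    exact Subgroup.subset_closure (by simp)
  have hC : eltC ∈ groupBC.subgroupOf groupAC := by
    rw [Subgroup.mem_subgroupOf, coe_eltC]
    exact Subgroup.subset_closure (by simp)
  rw [hg, mem_map_conj_iff, mem_groupA_iff] at hB hC
  obtain ⟨m, hm⟩ := Subgroup.mem_zpowers_iff.1 hB
  obtain ⟨n, hn⟩ := Subgroup.mem_zpowers_iff.1 hC
  have h1 : Commute (g⁻¹ * eltB * g) (g⁻¹ * eltC * g) := by
    rw [← hm, ← hn]
    exact Commute.zpow_zpow_self _ _ _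
  have h2 : eltB * eltC = eltC * eltB := by
    have h3 := h1.eq
    have h4 : ∀ x y : groupAC, g⁻¹ * x * g * (g⁻¹ * y * g) = g⁻¹ * (x * y) * g := by
      intro x y
      group
    rw [h4, h4] at h3
    exact mul_left_cancel (mul_right_cancel h3)
  have h5 := congrArg Subtype.val h2
  rw [Subgroup.coe_mul, Subgroup.coe_mul, coe_eltB, coe_eltC] at h5
  revert h5
  decide +kernel

theorem normal_affineImage_bot (hΦ : MatchesLines Φ) :
    (affineImage (affineEquivAut hΦ) ⊥).Normal := by
  refine ⟨fun x hx g => ?_⟩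
  obtain ⟨f, rfl⟩ := (affineEquivAut hΦ).surjective x
  obtain ⟨m, rfl⟩ := (affineEquivAut hΦ).surjective g
  rw [hasLinearPart_affineImage hΦ ⊥] at hx
  have h1 : linearPart f = 1 := Subtype.ext hx
  rw [← map_inv, ← map_mul, ← map_mul, hasLinearPart_affineImage hΦ ⊥, map_mul, map_mul, map_inv,
    h1, mul_one, mul_inv_cancel]
  exact one_mem _

theorem existsUnique_translation (hΦ : MatchesLines Φ) (p q : slantedGroup F) :
    ∃! g : slantedQuadrangle F ≃g slantedQuadrangle F,
      g ∈ affineImage (affineEquivAut hΦ) ⊥ ∧ g (Sum.inl p) = Sum.inl q := by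
  refine ⟨affineEquivAut hΦ (affineMk (vecEquiv Φ q - vecEquiv Φ p) 1),
    ⟨(hasLinearPart_affineImage hΦ ⊥ _).2 (one_mem _), ?_⟩, ?_⟩
  · rw [affineEquivAut_inl, affineApply_affineMk]
    simp
  · rintro g ⟨hg, hgp⟩
    obtain ⟨f, rfl⟩ := (affineEquivAut hΦ).surjective g
    have h1 : linearPart f = 1 := Subtype.ext ((hasLinearPart_affineImage hΦ ⊥ f).1 hg)
    rw [affineEquivAut_inl] at hgp
    have h2 := (Equiv.symm_apply_eq _).1 (Sum.inl_injective hgp)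
    rw [← affineMk_linearPart f, h1, affineApply_affineMk] at h2
    have h3 : vecEquiv Φ p + f.1.left.toAdd = vecEquiv Φ q := by simpa using h2
    rw [← affineMk_linearPart f, h1, ← h3, add_sub_cancel_left]

end Chambers

end SlantedQuadrangle

open SlantedQuadrangle
theorem proposition4p2 {F : Type*} [Field F] (hF : Nat.card F = 4) (α : F)
    (hα : α ^ 2 + α + 1 = 0) :
    -- the identification of the points with the vectors of `V`
    ∃ Φ : slantedGroup F ≃* Multiplicative V, IsCoordinateIso α Φ ∧
    -- `V ⋊ ⟨A, C⟩`, acting on the points by affine maps, is the full automorphism group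
    (∃ Θ : affineGroup groupAC ≃* (slantedQuadrangle F ≃g slantedQuadrangle F),
      (∀ (f : affineGroup groupAC) (p : slantedGroup F),
        Θ f (Sum.inl p) = Sum.inl (Φ.symm (.ofAdd (affineApply f.1 (Φ p).toAdd)))) ∧
      -- the translation group `V` is normal and regular on the points
      (affineImage Θ ⊥).Normal ∧
      (∀ p q : slantedGroup F, ∃! g : slantedQuadrangle F ≃g slantedQuadrangle F,
        g ∈ affineImage Θ ⊥ ∧ g (Sum.inl p) = Sum.inl q) ∧
      -- the chamber-regular subgroups that contain `V`, up to conjugacy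
      groupA ≤ groupAC ∧ groupBC ≤ groupAC ∧
      (∀ H : Subgroup (slantedQuadrangle F ≃g slantedQuadrangle F),
        (IsChamberRegular H ∧ affineImage Θ ⊥ ≤ H) ↔
          (AreConjugate H (affineImage Θ groupA) ∨ AreConjugate H (affineImage Θ groupBC))) ∧
      ¬ AreConjugate (affineImage Θ groupA) (affineImage Θ groupBC)) ∧
    -- `⟨A, C⟩` permutes `U₁, …, U₆`, which makes it a non-split extension of `C₃` by `Sym(6)`
    (∃ Ψ : groupAC →* Equiv.Perm (Fin 6),
      (∀ (g : groupAC) (i : Fin 6), (U i).map (Matrix.mulVecLin g.1.val) = U (Ψ g i)) ∧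
      orderOf matD = 3 ∧
      Ψ.ker.map groupAC.subtype = Subgroup.zpowers matD ∧
      Ψ ⟨matA, matA_mem⟩ = List.formPerm [0, 4, 1, 2, 3, 5] ∧
      Ψ ⟨matC, matC_mem⟩ = List.formPerm [0, 2, 4] * List.formPerm [1, 3, 5] ∧
      Function.Surjective Ψ ∧
      ¬ ∃ s : Equiv.Perm (Fin 6) →* groupAC, Ψ.comp s = MonoidHom.id (Equiv.Perm (Fin 6))) := by
  obtain ⟨Φ, hcoord, hΦ⟩ := exists_coordinateIso hF hα
  have hA := hasLinearPart_affineImage (Φ := Φ) hΦ groupA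
  have hBC := hasLinearPart_affineImage (Φ := Φ) hΦ groupBC
  refine ⟨Φ, hcoord, ⟨affineEquivAut hΦ, affineEquivAut_inl hΦ, normal_affineImage_bot hΦ,
    existsUnique_translation hΦ, groupA_le, groupBC_le, fun H => ⟨?_, ?_⟩, ?_⟩,
    typeHom, map_U, orderOf_matD, map_typeHom_ker, typeHom_A, typeHom_C, typeHom_surjective,
    not_split⟩
  · rintro ⟨hreg, hV⟩
    obtain ⟨K, hK⟩ := exists_hasLinearPart hV
    rw [hK.areConjugate_iff hA, hK.areConjugate_iff hBC]
    exact (hK.isChamberRegular_iff.1 hreg).conj_groupA_or_groupBC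
  · rintro (h | h)
    · exact hA.isChamberRegular_of_areConjugate isTypeRegular_groupA h
    · exact hBC.isChamberRegular_of_areConjugate isTypeRegular_groupBC h
  · rw [hA.areConjugate_iff hBC]
    exact not_areConjugate_groupA_groupBC
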